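/- Let $K$ be a field and let $A$ be a connected Nakayama algebra over $K$; that is, $A$ is a nonzero finite-dimensional $K$-algebra whose only central idempotents are $0$ and $1$, and every indecomposable projective left $A$-module and every indecomposable projective right $A$-module is uniserial (has a unique composition series). Let $M$ and $N$ be indecomposable (left) $A$-modules, and for an $A$-module $X$ let $\Omega^1(X)$ denote the first syzygy of $X$, i.e. the kernel of a projective cover $P \to X$ (unique up to isomorphism). Then: (1) $\dim_K \operatorname{Hom}_A(\Omega^1(M), N) \ge \min\bigl(\dim_K \operatorname{Hom}_A(\Omega^1(M), M),\ \dim_K \operatorname{Hom}_A(\Omega^1(N), N)\bigr)$; (2) $\dim_K \operatorname{Ext}^1_A(M, N) \ge \min\bigl(\dim_K \operatorname{Ext}^1_A(M, M),\ \dim_K \operatorname{Ext}^1_A(N, N)\bigr)$. (As the definition of a Nakayama algebra is left-right symmetric, the same holds for right modules.) -/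

import Mathlib

open CategoryTheory CategoryTheory.Limits

universe u

/-- A module is uniserial if it has a unique composition series, that is, a unique finite chain of
submodules from `⊥` to `⊤` each of which is a maximal submodule of the next one. -/
def IsUniserial (A : Type*) [Ring A] (M : Type*) [AddCommGroup M] [Module A M] : Prop :=
  ∃! s : CompositionSeries (Submodule A M), s.head = ⊥ ∧ s.last = ⊤

/-- A Nakayama algebra over the field `K`: a finite-dimensional algebra over which every
indecomposable projective left module and every indecomposable projective right module
(a right `A`-module is a left `Aᵐᵒᵖ`-module) is uniserial. -/
structure IsNakayamaAlgebra (K : Type*) [Field K] (A : Type u) [Ring A] [Algebra K A] : Prop where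
  finite : Module.Finite K A
  left_uniserial : ∀ P : ModuleCat.{u} A,
    Module.Projective A P → Indecomposable P → IsUniserial A P
  right_uniserial : ∀ P : ModuleCat.{u} Aᵐᵒᵖ,
    Module.Projective Aᵐᵒᵖ P → Indecomposable P → IsUniserial Aᵐᵒᵖ P

/-- A ring is connected if it is nonzero and not a product of two nonzero rings, that is,
`0 ≠ 1` are its only central idempotents. -/
def IsConnectedRing (A : Type*) [Ring A] : Prop :=
  Nontrivial A ∧ ∀ e : A, IsIdempotentElem e → e ∈ Subring.center A → e = 0 ∨ e = 1

/-- `p : P ⟶ M` is a projective cover: `P` is projective, `p` is surjective and the kernel of `p`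
is superfluous, i.e. no proper submodule of `P` together with it generates `P`. -/
structure IsProjectiveCover {A : Type u} [Ring A] {P M : ModuleCat.{u} A} (p : P ⟶ M) : Prop where
  projective : Module.Projective A P
  surjective : Function.Surjective p.hom
  superfluous : ∀ U : Submodule A P, U ⊔ LinearMap.ker p.hom = ⊤ → U = ⊤

/-- `X` is (isomorphic to) the first syzygy `Ω¹(M)`: the kernel of a projective cover of `M`. This
determines `X` up to isomorphism, since projective covers are unique up to isomorphism. -/
def IsFirstSyzygy {A : Type u} [Ring A] (X M : ModuleCat.{u} A) : Prop :=
  ∃ (P : ModuleCat.{u} A) (p : P ⟶ M), IsProjectiveCover p ∧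
    Nonempty (X ≅ ModuleCat.of A (LinearMap.ker p.hom))

/-! Decompose `1` into primitive idempotents `e i`. Uniseriality makes the submodules of each `A * e
i` and `e i * A` chains, so the maximal submodule of `A * e i` is generated by one arrow `x i` from
`i` to `s i`, and the path of `t` arrows generates the `t`-th radical power of `A * e i`. Every
indecomposable module is a quotient of some `A * e i` by such a power (`exists_isCompl_span`), so it
is described by a pair (top, length), recorded in `HasTop`.

Let `M = (i, m)`, `N = (k, m')`, and let `L`, `L'` be the lengths of `A * e i`, `A * e k`. The
syzygy of `M` is `(s^[m] i, L - m)` (`HasTop.kerGenerator`). A map from it to `N` amounts to an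
element of the Peirce part at `s^[m] i` of the radical layer `m' - (L - m)` of `N`
(`HasTop.range_homEval`). Maps extending to the projective cover take values in the layer `m + j`,
where `j` is the first position of the top of `M` on the chain of `N` (`HasTop.rank_range_le`).
Since Ext¹ is the cokernel of restriction from the cover, its dimension is bounded below by counting
positions in the interval from `m' - (L - m)` to `min m' (m + j)`.

If Hom(ΩM, M) = 0 there is nothing to prove. Otherwise the chain of arrows from `i` closes up;
connectedness puts every idempotent on this cycle, of some length `n`. Positions are then compared
modulo `n` (`exists_position`), and each occurrence contributes the same dimension `d`. In Hom(ΩM,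
M) the relevant residue is that of the right end `m` of the interval, so the number of occurrences
times `n` is at most `min m (L - m)`; likewise for `N`. With `L' ≤ L + j`, the interval for Ext¹(M,
N) contains `r * n` integers, `r` being the smaller count, hence `r` in any residue class.

This gives min(dim Hom(ΩM, M), dim Hom(ΩN, N)) ≤ dim Ext¹(M, N) (`min_rank_hom_le_rank_ext`). Both
assertions follow, because Ext¹(X, Y) is always a quotient of Hom(ΩX, Y). -/

/-! ### Idempotents, local corners and arrows -/

/-- `a` lies in the Peirce component `e k * A * e i`. -/
def Peirce {A ι : Type*} [Ring A] (e : ι → A) (k i : ι) (a : A) : Prop :=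
  e k * a = a ∧ a * e i = a

/-- Complete orthogonal nonzero idempotents `e i` such that the submodules of the left modules
`A * e i` and of the right modules `e i * A` form chains. -/
structure IsSerialFamily {A ι : Type*} [Ring A] [Fintype ι] (e : ι → A) : Prop where
  complete : CompleteOrthogonalIdempotents e
  ne_zero : ∀ i, e i ≠ 0
  left_total : ∀ i (a b : A), a * e i = a → b * e i = b → (∃ c, a = c * b) ∨ ∃ c, b = c * a
  right_total : ∀ i (a b : A), e i * a = a → e i * b = b → (∃ c, a = b * c) ∨ ∃ c, b = a * c

/-- The idempotents `e i` and `e k` are isomorphic. -/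
def IdemRel {A ι : Type*} [Ring A] (e : ι → A) (i k : ι) : Prop :=
  ∃ a b, Peirce e k i a ∧ Peirce e i k b ∧ b * a = e i ∧ a * b = e k

/-- `x` generates the maximal submodule of the left module `A * e i`. -/
structure IsArrow {A ι : Type*} [Ring A] (e : ι → A) (i k : ι) (x : A) : Prop where
  peirce : Peirce e k i x
  nongen : ¬∃ c, c * x = e i
  dvd : ∀ a, a * e i = a → (¬∃ c, c * a = e i) → ∃ c, a = c * x

section Basic

variable {A ι : Type*} [Ring A] {e : ι → A}

lemma Peirce.mul {i j k : ι} {a b : A} (ha : Peirce e k j a) (hb : Peirce e j i b) :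
    Peirce e k i (a * b) :=
  ⟨by rw [← mul_assoc, ha.1], by rw [mul_assoc, hb.2]⟩

lemma Peirce.smul_mem {V : Type*} [AddCommGroup V] [Module A V] {i k : ι} {a : A}
    (ha : Peirce e k i a) (v : V) : e k • a • v = a • v := by
  rw [← mul_smul, ha.1]

lemma IdemRel.symm {i k : ι} (h : IdemRel e i k) : IdemRel e k i := by
  obtain ⟨a, b, ha, hb, h1, h2⟩ := h
  exact ⟨b, a, hb, ha, h2, h1⟩

lemma IdemRel.trans {i j k : ι} (h : IdemRel e i j) (h' : IdemRel e j k) : IdemRel e i k := by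
  obtain ⟨a, b, ha, hb, h1, h2⟩ := h
  obtain ⟨a', b', ha', hb', h1', h2'⟩ := h'
  refine ⟨a' * a, b * b', ha'.mul ha, hb.mul hb', ?_, ?_⟩
  · rw [mul_assoc, ← mul_assoc b', h1', ha.1, h1]
  · rw [mul_assoc, ← mul_assoc a, h2, hb'.1, h2']

lemma IdemRel.congr_right {i j k : ι} (hjk : IdemRel e j k) : IdemRel e i j ↔ IdemRel e i k :=
  ⟨fun hij => hij.trans hjk, fun hik => hik.trans hjk.symm⟩

end Basic

namespace IsSerialFamily

variable {A ι : Type*} [Ring A] [Fintype ι] {e : ι → A} (h : IsSerialFamily e)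

include h

lemma idem (i : ι) : e i * e i = e i := h.complete.idem i

lemma peirce_self (i : ι) : Peirce e i i (e i) := ⟨h.idem i, h.idem i⟩

lemma peirce_mk (k i : ι) (a : A) : Peirce e k i (e k * a * e i) :=
  ⟨by rw [← mul_assoc, ← mul_assoc, h.idem], by rw [mul_assoc, h.idem]⟩

lemma rel_refl (i : ι) : IdemRel e i i :=
  ⟨e i, e i, h.peirce_self i, h.peirce_self i, h.idem i, h.idem i⟩

lemma sum_smul {V : Type*} [AddCommGroup V] [Module A V] (v : V) : ∑ i, e i • v = v := by
  rw [← Finset.sum_smul, h.complete.complete, one_smul]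

lemma exists_smul_ne_zero {V : Type*} [AddCommGroup V] [Module A V] {v : V} (hv : v ≠ 0) :
    ∃ i, e i • v ≠ 0 := by
  by_contra! hc
  exact hv (by rw [← h.sum_smul v]; simp [hc])

/-- The left non-generators of `A * e i` absorb sums. -/
lemma gen_of_add {i : ι} {a b : A} (ha : a * e i = a) (hb : b * e i = b)
    (hc : ∃ c, c * (a + b) = e i) : (∃ c, c * a = e i) ∨ ∃ c, c * b = e i := by
  obtain ⟨c, hc⟩ := hc
  rcases h.left_total i a b ha hb with ⟨d, rfl⟩ | ⟨d, rfl⟩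
  · exact .inr ⟨c * (d + 1), by rw [← hc]; noncomm_ring⟩
  · exact .inl ⟨c * (1 + d), by rw [← hc]; noncomm_ring⟩

/-- The corner at `i` is local. The descending chain condition gives `a ^ n = c * a ^ (n + 1)`, and
since `e i * c * a` is a non-generator, `e i - e i * c * a` is left invertible by `gen_of_add` and
kills a power of `a`. -/
lemma isNilpotent [IsArtinianRing A] {i : ι} {a : A} (ha : Peirce e i i a)
    (hn : ¬∃ c, c * a = e i) : IsNilpotent a := by
  obtain ⟨n, hst⟩ := IsArtinian.monotone_stabilizes (R := A) (M := A)
    ⟨fun n => OrderDual.toDual (Submodule.span A {a ^ n}), by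
      refine monotone_nat_of_le_succ fun n => ?_
      rw [OrderDual.toDual_le_toDual, Submodule.span_singleton_le_iff_mem, pow_succ']
      exact Submodule.smul_mem _ a (Submodule.mem_span_singleton_self _)⟩
  have h1 : Submodule.span A {a ^ n} = Submodule.span A {a ^ (n + 1)} := hst (n + 1) n.le_succ
  have h2 : a ^ n ∈ Submodule.span A {a ^ (n + 1)} := h1 ▸ Submodule.mem_span_singleton_self _
  obtain ⟨c, hc⟩ := Submodule.mem_span_singleton.1 h2
  rw [smul_eq_mul] at hc
  have key : ∃ w, w * (e i - e i * c * a) = e i := by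
    rcases h.gen_of_add (i := i) (a := e i - e i * c * a) (b := e i * c * a)
      (by rw [sub_mul, h.idem, mul_assoc, ha.2]) (by rw [mul_assoc, ha.2])
      ⟨e i, by rw [sub_add_cancel, h.idem]⟩ with h3 | ⟨w, hw⟩
    · exact h3
    · exact absurd ⟨w * (e i * c), by rw [mul_assoc, hw]⟩ hn
  obtain ⟨w, hw⟩ := key
  refine ⟨n + 1, ?_⟩
  have h4 : (e i - e i * c * a) * a ^ (n + 1) = 0 := by
    have : c * a * a ^ (n + 1) = a ^ (n + 1) := by
      rw [mul_assoc, ← pow_succ', pow_succ, ← mul_assoc, hc, ← pow_succ]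
    rw [sub_mul, mul_assoc, mul_assoc, ← mul_assoc c, this, sub_self]
  calc a ^ (n + 1) = e i * a ^ (n + 1) := by rw [pow_succ', ← mul_assoc, ha.1]
    _ = 0 := by rw [← hw, mul_assoc, h4, mul_zero]

omit h [Fintype ι] in
lemma _root_.IsNilpotent.eq_zero_of_smul_eq {V : Type*} [AddCommGroup V] [Module A V] {a : A}
    {x : V} (ha : IsNilpotent a) (hx : a • x = x) : x = 0 := by
  obtain ⟨n, hn⟩ := ha
  have : ∀ n : ℕ, a ^ n • x = x := fun n => by
    induction n with
    | zero => simp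
    | succ n ih => rw [pow_succ, mul_smul, hx, ih]
  rw [← this n, hn, zero_smul]

omit h [Fintype ι] in
lemma _root_.IsNilpotent.eq_zero_of_mul_eq_right {a x : A} (ha : IsNilpotent a) (hx : x * a = x) :
    x = 0 := by
  obtain ⟨n, hn⟩ := ha
  have : ∀ n : ℕ, x * a ^ n = x := fun n => by
    induction n with
    | zero => simp
    | succ n ih => rw [pow_succ', ← mul_assoc, hx, ih]
  rw [← this n, hn, mul_zero]

lemma eq_of_idem [IsArtinianRing A] {i : ι} {g : A} (hg : Peirce e i i g) (hgg : g * g = g)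
    (h0 : g ≠ 0) : g = e i := by
  by_cases hn : ∃ c, c * g = e i
  · obtain ⟨c, hc⟩ := hn
    rw [← hg.1, ← hc, mul_assoc, hgg]
  · exact absurd ((h.isNilpotent hg hn).eq_zero_of_smul_eq hgg) h0

/-- A one-sided inverse `b` is two-sided: `a * b` is a nonzero idempotent of a local corner, hence
its identity. -/
lemma iso_of_left [IsArtinianRing A] {i k : ι} {a : A} (ha : Peirce e k i a)
    (hc : ∃ c, c * a = e i) : ∃ b, Peirce e i k b ∧ b * a = e i ∧ a * b = e k := by
  obtain ⟨c, hc⟩ := hc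
  have h1 : e i * c * e k * a = e i := by rw [mul_assoc, ha.1, mul_assoc, hc, h.idem]
  refine ⟨e i * c * e k, h.peirce_mk _ _ _, h1, ?_⟩
  refine h.eq_of_idem (ha.mul (h.peirce_mk _ _ _)) ?_ fun h0 => ?_
  · rw [mul_assoc a, ← mul_assoc _ a, h1, ← mul_assoc, ha.2]
  · have : e i * c * e k * (a * (e i * c * e k)) * a = e i := by
      rw [mul_assoc, mul_assoc a, h1, ha.2, h1]
    rw [h0, mul_zero, zero_mul] at this
    exact h.ne_zero i this.symm

lemma iso_of_right [IsArtinianRing A] {i k : ι} {a : A} (ha : Peirce e k i a)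
    (hc : ∃ c, a * c = e k) : ∃ b, Peirce e i k b ∧ b * a = e i ∧ a * b = e k := by
  obtain ⟨c, hc⟩ := hc
  have h1 : a * (e i * c * e k) = e k := by
    rw [← mul_assoc, ← mul_assoc, ha.2, hc, h.idem]
  refine ⟨e i * c * e k, h.peirce_mk _ _ _, ?_, h1⟩
  refine h.eq_of_idem ((h.peirce_mk _ _ _).mul ha) ?_ fun h0 => ?_
  · rw [mul_assoc, ← mul_assoc a, h1, ha.1]
  · have : a * (e i * c * e k * a) * (e i * c * e k) = e k := by
      rw [← mul_assoc a, h1, ha.1, h1]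
    rw [h0, mul_zero, zero_mul] at this
    exact h.ne_zero k this.symm

lemma rel_of_left [IsArtinianRing A] {i k : ι} {a : A} (ha : Peirce e k i a)
    (hc : ∃ c, c * a = e i) : IdemRel e i k := by
  obtain ⟨b, hb, h1, h2⟩ := h.iso_of_left ha hc
  exact ⟨a, b, ha, hb, h1, h2⟩

/-- If a product of elements of Peirce components generates, so does the first factor. -/
lemma gen_of_mul [IsArtinianRing A] {i k : ι} {a b : A} (ha : a * e i = a) (hb : Peirce e i k b)
    (hc : ∃ c, c * (a * b) = e k) : ∃ c, c * a = e i := by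
  obtain ⟨d, hd⟩ := hc
  obtain ⟨b', hb', h1, h2⟩ := h.iso_of_left hb ⟨d * a, by rw [mul_assoc, hd]⟩
  refine ⟨b * d, ?_⟩
  have h3 : d * a = e k * b' := by
    rw [← hd, mul_assoc d, mul_assoc a, h2, ha]
  rw [mul_assoc, h3, hb'.1, h2]

lemma exists_dominating [IsNoetherianRing A] {i : ι} (S : Set A) (hS : S.Nonempty)
    (hSi : ∀ a ∈ S, a * e i = a) : ∃ x ∈ S, ∀ a ∈ S, ∃ c, a = c * x := by
  obtain ⟨_, ⟨x, hx, rfl⟩, hmax⟩ := set_has_maximal_iff_noetherian.2 (inferInstanceAs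
    (IsNoetherian A A)) ((fun a => Submodule.span A {a}) '' S) (hS.image _)
  refine ⟨x, hx, fun a ha => ?_⟩
  rcases h.left_total i a x (hSi a ha) (hSi x hx) with hc | ⟨c, hc⟩
  · exact hc
  · have h1 : Submodule.span A {x} ≤ Submodule.span A {a} := by
      rw [Submodule.span_singleton_le_iff_mem, hc]
      exact Submodule.smul_mem _ c (Submodule.mem_span_singleton_self _)
    have h2 := eq_of_le_of_not_lt h1 (hmax _ ⟨a, ha, rfl⟩)
    have h3 : a ∈ Submodule.span A {x} := h2 ▸ Submodule.mem_span_singleton_self _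
    obtain ⟨d, hd⟩ := Submodule.mem_span_singleton.1 h3
    exact ⟨d, hd.symm⟩

/-- Among the homogeneous non-generators one divides all others, and every non-generator is a sum of
homogeneous ones. The arrow is zero when `A * e i` is simple, and then its target `k` carries no
information. -/
lemma exists_arrow [IsArtinianRing A] (i : ι) : ∃ k x, IsArrow e i k x := by
  obtain ⟨x, ⟨k, hx, hxn⟩, hdom⟩ := h.exists_dominating (i := i)
    {a | ∃ k, Peirce e k i a ∧ ¬∃ c, c * a = e i}
    ⟨0, i, ⟨mul_zero _, zero_mul _⟩, fun ⟨c, hc⟩ => h.ne_zero i (by rw [← hc, mul_zero])⟩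
    (fun a ⟨k, ha, _⟩ => ha.2)
  refine ⟨k, x, hx, hxn, fun a ha han => ?_⟩
  have : ∀ j, ∃ c, e j * a = c * x := fun j => by
    refine hdom _ ⟨j, ⟨by rw [← mul_assoc, h.idem], by rw [mul_assoc, ha]⟩, ?_⟩
    rintro ⟨c, hc⟩
    exact han ⟨c * e j, by rw [mul_assoc, hc]⟩
  choose c hc using this
  refine ⟨∑ j, c j, ?_⟩
  rw [Finset.sum_mul, ← Finset.sum_congr rfl fun j _ => hc j, ← Finset.sum_mul,
    h.complete.complete, one_mul]

lemma exists_dominating_right {k : ι} {a : A} (ha : e k * a = a) :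
    ∃ j c, a = a * e j * c := by
  classical
  have key : ∀ s : Finset ι, s.Nonempty → ∃ j, ∀ l ∈ s, ∃ c, a * e l = a * e j * c := by
    intro s hs
    induction hs using Finset.Nonempty.cons_induction with
    | singleton l => exact ⟨l, fun l' hl' => ⟨1, by rw [Finset.mem_singleton.1 hl', mul_one]⟩⟩
    | cons l s hl hs ih =>
      obtain ⟨j, hj⟩ := ih
      rcases h.right_total k (a * e j) (a * e l) (by rw [← mul_assoc, ha])
        (by rw [← mul_assoc, ha]) with ⟨c, hc⟩ | ⟨c, hc⟩
      · refine ⟨l, fun l' hl' => ?_⟩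
        rcases Finset.mem_cons.1 hl' with rfl | hl'
        · exact ⟨1, (mul_one _).symm⟩
        · obtain ⟨d, hd⟩ := hj l' hl'
          exact ⟨c * d, by rw [hd, hc, mul_assoc]⟩
      · refine ⟨j, fun l' hl' => ?_⟩
        rcases Finset.mem_cons.1 hl' with rfl | hl'
        · exact ⟨c, hc⟩
        · exact hj l' hl'
  obtain ⟨j, hj⟩ := key Finset.univ ⟨k, Finset.mem_univ _⟩
  choose! c hc using hj
  refine ⟨j, ∑ l, c l, ?_⟩
  rw [Finset.mul_sum, ← Finset.sum_congr rfl hc, ← Finset.mul_sum, h.complete.complete, mul_one]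

/-- A nonzero arrow also generates the maximal submodule of the right module at its end. -/
lemma _root_.IsArrow.dvd_right [IsArtinianRing A] {i k : ι} {x : A}
    (hx : IsArrow e i k x) (hx0 : x ≠ 0)
    {a : A} (ha : e k * a = a) (han : ¬∃ c, a * c = e k) : ∃ c, a = x * c := by
  obtain ⟨j, u, hu⟩ := h.exists_dominating_right ha
  have haj : Peirce e k j (a * e j) := ⟨by rw [← mul_assoc, ha], by rw [mul_assoc, h.idem]⟩
  suffices hs : ∃ c, a * e j = x * c by
    obtain ⟨c, hc⟩ := hs
    exact ⟨c * u, by rw [hu, hc, mul_assoc]⟩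
  rcases h.right_total k (a * e j) x haj.1 hx.peirce.1 with hc | ⟨c, hc⟩
  · exact hc
  have hc' : x = a * e j * (e j * c * e i) := by
    rw [← mul_assoc, ← mul_assoc, haj.2, ← hc, hx.peirce.2]
  by_cases hg : ∃ d, d * (e j * c * e i) = e i
  · obtain ⟨b, hb, h1, h2⟩ := h.iso_of_left (h.peirce_mk _ _ _) hg
    exact ⟨b, by rw [hc', mul_assoc, h2, haj.2]⟩
  · obtain ⟨d, hd⟩ := hx.dvd _ (h.peirce_mk _ _ _).2 hg
    -- If neither `a * e j` nor the cofactor of `x` is a generator, `x` is fixed by a nilpotent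
    -- corner element and so vanishes.
    have h3 : a * e j * (e j * d * e k) * x = x := by
      rw [mul_assoc, mul_assoc _ (e k), hx.peirce.1, mul_assoc (e j) d, ← hd, ← mul_assoc (a * e j),
        haj.2, ← hc']
    have h4 : ¬∃ w, w * (a * e j * (e j * d * e k)) = e k := fun hw => by
      obtain ⟨b, -, -, hb⟩ := h.iso_of_left (haj.mul (h.peirce_mk _ _ _)) hw
      exact han ⟨e j * (e j * d * e k) * b, by rw [← mul_assoc, ← mul_assoc, hb]⟩
    exact absurd ((h.isNilpotent (haj.mul (h.peirce_mk _ _ _)) h4).eq_zero_of_smul_eq h3) hx0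

lemma gen_of_mul_eq_self [IsArtinianRing A] {i : ι} {a x : A} (ha : Peirce e i i a)
    (hx : a * x = x) (hx0 : x ≠ 0) : ∃ c, c * a = e i := by
  by_contra hn
  exact hx0 ((h.isNilpotent ha hn).eq_zero_of_smul_eq hx)

lemma gen_of_mul_eq_self_right [IsArtinianRing A] {i : ι} {a x : A} (ha : Peirce e i i a)
    (hx : x * a = x) (hx0 : x ≠ 0) : ∃ c, c * a = e i := by
  by_contra hn
  exact hx0 ((h.isNilpotent ha hn).eq_zero_of_mul_eq_right hx)

/-- Transporting each arrow along the isomorphism of sources expresses it through the other.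
Composing, a corner element factoring through `e k'` fixes `x ≠ 0`; it is not nilpotent, so it is
invertible and the targets are isomorphic. -/
lemma succ_rel [IsArtinianRing A] {i k i' k' : ι} {x y : A} (hx : IsArrow e i i' x)
    (hy : IsArrow e k k' y) (hik : IdemRel e i k) (hx0 : x ≠ 0) : y ≠ 0 ∧ IdemRel e i' k' := by
  obtain ⟨u, v, hu, hv, hvu, huv⟩ := hik
  obtain ⟨c, hc⟩ := hy.dvd (x * v) (by rw [mul_assoc, hv.2])
    (fun hg => hx.nongen (h.gen_of_mul hx.peirce.2 hv hg))
  obtain ⟨c', hc'⟩ := hx.dvd (y * u) (by rw [mul_assoc, hu.2])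
    (fun hg => hy.nongen (h.gen_of_mul hy.peirce.2 hu hg))
  have h1 : e i' * c * e k' * (e k' * c' * e i') * x = x := by
    have h2 : e k' * c' * e i' * x = y * u := by
      rw [mul_assoc, hx.peirce.1, mul_assoc, ← hc', ← mul_assoc, hy.peirce.1]
    rw [mul_assoc, h2, mul_assoc _ (e k'), ← mul_assoc (e k'), hy.peirce.1, ← mul_assoc,
      mul_assoc (e i'), ← hc, mul_assoc (e i'), mul_assoc x, hvu, hx.peirce.2, hx.peirce.1]
  refine ⟨?_, ?_⟩
  · rintro rfl
    rw [mul_zero] at hc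
    exact hx0 (by rw [← hx.peirce.2, ← hvu, ← mul_assoc, hc, zero_mul])
  · obtain ⟨d, hd⟩ := h.gen_of_mul_eq_self ((h.peirce_mk _ _ _).mul (h.peirce_mk _ _ _)) h1 hx0
    exact h.rel_of_left (h.peirce_mk k' i' c') ⟨d * (e i' * c * e k'), by rw [mul_assoc, hd]⟩

/-- Dual to `succ_rel`: nonzero arrows also generate the radicals of the right modules at their
ends, so arrows can be followed backwards. -/
lemma pred_rel [IsArtinianRing A] {i k i' k' : ι} {x y : A} (hx : IsArrow e i i' x)
    (hy : IsArrow e k k' y) (hik : IdemRel e i' k') (hx0 : x ≠ 0) (hy0 : y ≠ 0) :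
    IdemRel e i k := by
  obtain ⟨u, v, hu, hv, hvu, huv⟩ := hik
  have aux : ∀ {i i' k' : ι} {x u v : A}, IsArrow e i i' x → Peirce e k' i' u → v * u = e i' →
      Peirce e i' k' v → ¬∃ d, u * x * d = e k' := by
    rintro i i' k' x u v hx hu hvu hv ⟨d, hd⟩
    have h1 : x * (d * u) = e i' := by
      calc x * (d * u) = v * (u * x * d) * u := by
            rw [← mul_assoc, ← mul_assoc, ← mul_assoc, hvu, hx.peirce.1, mul_assoc]
        _ = e i' := by rw [hd, hv.2, hvu]
    obtain ⟨b, -, hb, -⟩ := h.iso_of_right hx.peirce ⟨_, h1⟩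
    exact hx.nongen ⟨b, hb⟩
  obtain ⟨c, hc⟩ := hy.dvd_right h hy0 (a := u * x) (by rw [← mul_assoc, hu.1])
    (aux hx hu hvu hv)
  obtain ⟨c', hc'⟩ := hx.dvd_right h hx0 (a := v * y) (by rw [← mul_assoc, hv.1])
    (aux hy hv huv hu)
  have h1 : x * (e i * c' * e k * (e k * c * e i)) = x := by
    have h2 : x * (e i * c' * e k) = v * y := by
      rw [← mul_assoc, ← mul_assoc, hx.peirce.2, ← hc', mul_assoc, hy.peirce.2]
    rw [← mul_assoc, h2, ← mul_assoc, ← mul_assoc, mul_assoc v, hy.peirce.2, mul_assoc v, ← hc,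
      ← mul_assoc, hvu, hx.peirce.1, hx.peirce.2]
  obtain ⟨d, hd⟩ := h.gen_of_mul_eq_self_right ((h.peirce_mk _ _ _).mul (h.peirce_mk _ _ _)) h1 hx0
  exact h.rel_of_left (h.peirce_mk k i c) ⟨d * (e i * c' * e k), by rw [mul_assoc, hd]⟩

end IsSerialFamily

/-! ### Paths and the radical filtration -/

/-- The composite of the `t` arrows starting at `i`. -/
def arrowPath {A ι : Type*} [Ring A] (e : ι → A) (s : ι → ι) (x : ι → A) (i : ι) : ℕ → A
  | 0 => e i
  | t + 1 => x (s^[t] i) * arrowPath e s x i t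

namespace IsSerialFamily

variable {A ι : Type*} [Ring A] [Fintype ι] {e : ι → A} (h : IsSerialFamily e)
  {s : ι → ι} {x : ι → A} (hx : ∀ i, IsArrow e i (s i) (x i))

include h hx

lemma path_peirce (i : ι) (t : ℕ) : Peirce e (s^[t] i) i (arrowPath e s x i t) := by
  induction t with
  | zero => exact h.peirce_self i
  | succ t ih =>
    rw [Function.iterate_succ_apply']
    exact (hx _).peirce.mul ih

lemma path_add (i : ι) (r t : ℕ) :
    arrowPath e s x (s^[t] i) r * arrowPath e s x i t = arrowPath e s x i (r + t) := by
  induction r with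
  | zero =>
    rw [zero_add]
    exact (h.path_peirce hx i t).1
  | succ r ih =>
    rw [Nat.succ_add, arrowPath, arrowPath, mul_assoc, ih, ← Function.iterate_add_apply]

lemma path_zero_of_le {i : ι} {t t' : ℕ} (ht : arrowPath e s x i t = 0) (htt' : t ≤ t') :
    arrowPath e s x i t' = 0 := by
  obtain ⟨r, rfl⟩ := Nat.exists_eq_add_of_le' htt'
  rw [← h.path_add hx, ht, mul_zero]

/-- Once the chain of generated left ideals stabilizes, the path is fixed by a left multiple of an
arrow; if it were nonzero, that arrow would generate. -/
lemma exists_path_eq_zero [IsArtinianRing A] (i : ι) : ∃ t, arrowPath e s x i t = 0 := by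
  obtain ⟨n, hst⟩ := IsArtinian.monotone_stabilizes (R := A) (M := A)
    ⟨fun n => OrderDual.toDual (Submodule.span A {arrowPath e s x i n}), by
      refine monotone_nat_of_le_succ fun n => ?_
      rw [OrderDual.toDual_le_toDual, Submodule.span_singleton_le_iff_mem]
      exact Submodule.smul_mem _ (x _) (Submodule.mem_span_singleton_self _)⟩
  have h1 : Submodule.span A {arrowPath e s x i n} = Submodule.span A {arrowPath e s x i (n + 1)} :=
    hst (n + 1) n.le_succ
  have h2 := h1 ▸ Submodule.mem_span_singleton_self (R := A) (arrowPath e s x i n)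
  obtain ⟨c, hc⟩ := Submodule.mem_span_singleton.1 h2
  rw [smul_eq_mul, arrowPath, ← mul_assoc] at hc
  refine ⟨n, ?_⟩
  have hp := h.path_peirce hx i n
  by_contra h0
  obtain ⟨d, hd⟩ := h.gen_of_mul_eq_self (i := s^[n] i) (a := e (s^[n] i) * (c * x (s^[n] i)))
    ⟨by rw [← mul_assoc, h.idem], by rw [mul_assoc, mul_assoc, (hx _).peirce.2]⟩
    (by rw [mul_assoc, hc, hp.1]) h0
  exact (hx (s^[n] i)).nongen ⟨d * e (s^[n] i) * c, by simpa only [mul_assoc] using hd⟩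

lemma exists_forall_path_eq_zero [IsArtinianRing A] : ∃ t, ∀ i, arrowPath e s x i t = 0 := by
  choose t ht using h.exists_path_eq_zero hx
  exact ⟨Finset.univ.sup t, fun i => h.path_zero_of_le hx (ht i) (Finset.le_sup (Finset.mem_univ i))⟩

/-- Elements of `A * e i` are multiples of a path with a generating cofactor. -/
lemma exists_eq_mul_path [IsArtinianRing A] {i k : ι} {a : A} (ha : Peirce e k i a) (ha0 : a ≠ 0) :
    ∃ t c, Peirce e k (s^[t] i) c ∧ (∃ d, d * c = e (s^[t] i)) ∧ a = c * arrowPath e s x i t := by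
  classical
  obtain ⟨L, hL⟩ := h.exists_path_eq_zero hx i
  -- The cofactor of the longest path dividing `a` must generate, since otherwise one more arrow
  -- could be split off.
  have hex : ∃ t, ¬∃ c, a = c * arrowPath e s x i t := ⟨L, fun ⟨c, hc⟩ => ha0 (by
    rw [hc, hL, mul_zero])⟩
  have hspec := Nat.find_spec hex
  obtain ⟨t, ht⟩ : ∃ t, Nat.find hex = t + 1 := Nat.exists_eq_succ_of_ne_zero fun h0 => by
    rw [h0] at hspec
    exact hspec ⟨a, ha.2.symm⟩
  rw [ht] at hspec
  obtain ⟨c, hc⟩ := not_not.1 (Nat.find_min hex (m := t) (by omega))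
  have hp := h.path_peirce hx i t
  have hc' : a = e k * c * e (s^[t] i) * arrowPath e s x i t := by
    rw [mul_assoc, hp.1, mul_assoc, ← hc, ha.1]
  refine ⟨t, _, h.peirce_mk _ _ c, ?_, hc'⟩
  by_contra hn
  obtain ⟨d, hd⟩ := (hx _).dvd _ (h.peirce_mk k (s^[t] i) c).2 hn
  exact hspec ⟨d, by rw [hc', hd, arrowPath, mul_assoc]⟩

/-- Powers of the radical are two-sided ideals. -/
lemma path_comm [IsArtinianRing A] {i k : ι} {a : A} (ha : Peirce e k i a) (t : ℕ) :
    ∃ c, Peirce e (s^[t] k) (s^[t] i) c ∧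
      arrowPath e s x k t * a = c * arrowPath e s x i t := by
  induction t with
  | zero => exact ⟨a, ha, by rw [arrowPath, arrowPath, ha.1, ha.2]⟩
  | succ t ih =>
    obtain ⟨c, hc, hca⟩ := ih
    obtain ⟨d, hd⟩ := (hx (s^[t] i)).dvd (x (s^[t] k) * c) (by rw [mul_assoc, hc.2])
      (fun hg => (hx _).nongen (h.gen_of_mul (hx _).peirce.2 hc hg))
    have hd' : x (s^[t] k) * c = e (s (s^[t] k)) * d * e (s (s^[t] i)) * x (s^[t] i) := by
      rw [mul_assoc, (hx _).peirce.1, mul_assoc, ← hd, ← mul_assoc, (hx _).peirce.1]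
    rw [Function.iterate_succ_apply', Function.iterate_succ_apply']
    exact ⟨_, h.peirce_mk _ _ d, by rw [arrowPath, arrowPath, mul_assoc, hca, ← mul_assoc, hd',
      mul_assoc]⟩

lemma path_eq_zero_of_rel [IsArtinianRing A] {i k : ι} (hik : IdemRel e i k) {t : ℕ}
    (ht : arrowPath e s x i t = 0) : arrowPath e s x k t = 0 := by
  obtain ⟨u, v, hu, hv, hvu, huv⟩ := hik
  obtain ⟨c, -, hc⟩ := h.path_comm hx hu t
  rw [← (h.path_peirce hx k t).2, ← huv, ← mul_assoc, hc, ht, mul_zero, zero_mul]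

lemma arrow_ne_zero {i : ι} {m t : ℕ} (hm : arrowPath e s x i m ≠ 0) (ht : t < m) :
    x (s^[t] i) ≠ 0 := fun h0 => hm <| h.path_zero_of_le hx (t := t + 1)
  (by rw [arrowPath, h0, zero_mul]) ht

omit hx in
/-- In a connected ring, a nonempty set of indices which is closed under the relation of being
linked by a nonzero Peirce component contains all indices. -/
lemma mem_of_connected (hA : IsConnectedRing A) (C : Set ι)
    (hC : ∀ i k a, Peirce e i k a → a ≠ 0 → (i ∈ C ↔ k ∈ C)) {i₀ : ι} (hi₀ : i₀ ∈ C) (i : ι) :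
    i ∈ C := by
  classical
  have hmul : ∀ j, e j * (∑ l ∈ Finset.univ.filter (· ∈ C), e l) = if j ∈ C then e j else 0 :=
    fun j => by
      simp only [Finset.mul_sum, h.complete.mul_eq]
      rw [Finset.sum_ite_eq]
      simp
  set f := ∑ l ∈ Finset.univ.filter (· ∈ C), e l with hf
  have hidem : IsIdempotentElem f := h.complete.toOrthogonalIdempotents.isIdempotentElem_sum
  have hcent : f ∈ Subring.center A := by
    rw [Subring.mem_center_iff]
    intro a
    have ha : a = ∑ j, ∑ l, e j * a * e l := by
      simp only [← Finset.mul_sum, h.complete.complete, mul_one, ← Finset.sum_mul, one_mul]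
    have hmul' : ∀ j, f * e j = if j ∈ C then e j else 0 := fun j => by
      simp only [hf, Finset.sum_mul, h.complete.mul_eq]
      rw [Finset.sum_ite_eq']
      simp
    conv_lhs => rw [ha]
    conv_rhs => rw [ha]
    simp only [Finset.sum_mul, Finset.mul_sum]
    refine Finset.sum_congr rfl fun j _ => Finset.sum_congr rfl fun l _ => ?_
    rw [mul_assoc, hmul, ← mul_assoc, ← mul_assoc, hmul']
    by_cases h0 : e j * a * e l = 0
    · split_ifs <;> simp [h0]
    · simp only [hC j l _ (h.peirce_mk j l a) h0]
      split_ifs <;> simp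
  rcases hA.2 f hidem hcent with h0 | h1
  · have := hmul i₀
    rw [h0, mul_zero, if_pos hi₀] at this
    exact absurd this.symm (h.ne_zero i₀)
  · by_contra hi
    have := hmul i
    rw [h1, mul_one, if_neg hi] at this
    exact h.ne_zero i this

/-! ### Cycles of arrows -/

section Cyclic

variable [IsArtinianRing A] {i₀ : ι} {n : ℕ} (hn : 0 < n) (hper : IdemRel e i₀ (s^[n] i₀))
  (hne : ∀ t, x (s^[t] i₀) ≠ 0)

omit hx in
-- Periodicity and nonvanishing are carried along together, since `succ_rel` transfers both from one
-- period to the next.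
lemma ne_zero_of_periodic (hx : ∀ i, IsArrow e i (s i) (x i)) {i : ι}
    (hn : 0 < n) (hper : IdemRel e i (s^[n] i)) (hne : ∀ t < n, x (s^[t] i) ≠ 0) (t : ℕ) :
    x (s^[t] i) ≠ 0 := by
  have : ∀ j, IdemRel e (s^[j] i) (s^[j + n] i) ∧ ∀ l < j + n, x (s^[l] i) ≠ 0 := fun j => by
    induction j with
    | zero => exact ⟨by simpa using hper, by simpa using hne⟩
    | succ j ih =>
      obtain ⟨h1, h2⟩ := h.succ_rel (hx _) (hx _) ih.1 (ih.2 j (by omega))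
      refine ⟨by rwa [Function.iterate_succ_apply', Nat.succ_add, Function.iterate_succ_apply'], ?_⟩
      intro l hl
      rcases (by omega : l < j + n ∨ l = j + n) with hl | rfl
      · exact ih.2 l hl
      · exact h1
  exact (this t).2 t (by omega)

include hne

lemma rel_add_iff (a b j : ℕ) :
    IdemRel e (s^[a + j] i₀) (s^[b + j] i₀) ↔ IdemRel e (s^[a] i₀) (s^[b] i₀) := by
  induction j with
  | zero => rfl
  | succ j ih =>
    rw [← ih, ← add_assoc, ← add_assoc, Function.iterate_succ_apply', Function.iterate_succ_apply']
    exact ⟨fun hab => h.pred_rel (hx _) (hx _) hab (hne _) (hne _),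
      fun hab => (h.succ_rel (hx _) (hx _) hab (hne _)).2⟩

include hper in
lemma rel_add_mul (a q : ℕ) : IdemRel e (s^[a] i₀) (s^[a + q * n] i₀) := by
  induction q with
  | zero => rw [zero_mul]; exact h.rel_refl _
  | succ q ih =>
    refine ih.trans ?_
    have := (h.rel_add_iff hx hne 0 n (a + q * n)).2 hper
    rwa [zero_add, show n + (a + q * n) = a + (q + 1) * n by ring] at this

include hper in
lemma rel_of_modEq {a b : ℕ} (hab : a ≡ b [MOD n]) : IdemRel e (s^[a] i₀) (s^[b] i₀) := by
  wlog hle : a ≤ b generalizing a b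
  · exact (this hab.symm (by omega)).symm
  obtain ⟨q, hq⟩ := (Nat.modEq_iff_dvd' hle).1 hab
  have := h.rel_add_mul hx hper hne a q
  rwa [mul_comm, ← hq, Nat.add_sub_cancel' hle] at this

include hn hper in
/-- In a connected algebra, a cycle contains all idempotents. -/
lemma exists_rel_iterate (hA : IsConnectedRing A) (i : ι) : ∃ t, IdemRel e i (s^[t] i₀) := by
  obtain ⟨L, hL⟩ := h.exists_forall_path_eq_zero hx
  refine h.mem_of_connected hA {i | ∃ t, IdemRel e i (s^[t] i₀)} ?_
    (i₀ := i₀) ⟨0, h.rel_refl _⟩ i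
  intro i k a ha ha0
  constructor
  · rintro ⟨t, ht⟩
    -- Iterates of `s` only go forward, so the base point is moved `L` periods ahead to leave room
    -- for `L` backward steps. If `k` were off the cycle, each step would split another arrow off `u
    -- * a`, until a path of length `L`, which is zero, divides it.
    have ht' : IdemRel e i (s^[t + L * n] i₀) := ht.trans (h.rel_add_mul hx hper hne t L)
    obtain ⟨u, v, hu, hv, hvu, huv⟩ := ht'
    have hua0 : u * a ≠ 0 := fun h0 => ha0 (by rw [← ha.1, ← hvu, mul_assoc, h0, mul_zero])
    by_contra hk
    have key : ∀ r ≤ L, ∃ c, Peirce e (s^[t + L * n - r] i₀) k c ∧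
        u * a = arrowPath e s x (s^[t + L * n - r] i₀) r * c := by
      intro r hr
      induction r with
      | zero => exact ⟨u * a, hu.mul ha, ((hu.mul ha).1).symm⟩
      | succ r ih =>
        obtain ⟨c, hc, hcu⟩ := ih (by omega)
        have hLn : L ≤ L * n := Nat.le_mul_of_pos_right L hn
        have hs : s^[t + L * n - r] i₀ = s (s^[t + L * n - (r + 1)] i₀) := by
          rw [← Function.iterate_succ_apply' s, show (t + L * n - (r + 1)).succ = t + L * n - r by omega]
        have hcn : ¬∃ d, c * d = e (s^[t + L * n - r] i₀) := fun hg => by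
          obtain ⟨b, hb, h1, h2⟩ := h.iso_of_right hc hg
          exact hk ⟨_, ⟨c, b, hc, hb, h1, h2⟩⟩
        rw [hs] at hc hcn
        obtain ⟨d, hd⟩ := (hx _).dvd_right h (hne _) hc.1 hcn
        have hd' : c = x (s^[t + L * n - (r + 1)] i₀) *
            (e (s^[t + L * n - (r + 1)] i₀) * d * e k) := by
          rw [← mul_assoc, ← mul_assoc, (hx _).peirce.2, ← hd, hc.2]
        refine ⟨_, h.peirce_mk _ _ d, ?_⟩
        rw [hcu, hs]
        conv_lhs => rw [hd']
        rw [← mul_assoc]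
        congr 1
        have := h.path_add hx (s^[t + L * n - (r + 1)] i₀) r 1
        rw [← this, Function.iterate_one, arrowPath, arrowPath, Function.iterate_zero_apply,
          (hx _).peirce.2]
    obtain ⟨c, -, hc⟩ := key L le_rfl
    exact hua0 (by rw [hc, hL, zero_mul])
  · rintro ⟨t, u, v, hu, hv, hvu, huv⟩
    have hav0 : a * v ≠ 0 := fun h0 => ha0 (by rw [← ha.2, ← hvu, ← mul_assoc, h0, zero_mul])
    obtain ⟨r, c, hc, hcg, -⟩ := h.exists_eq_mul_path hx (ha.mul hv) hav0
    refine ⟨r + t, ?_⟩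
    rw [Function.iterate_add_apply]
    exact (h.rel_of_left hc hcg).symm

include hn hper in
/-- The isomorphism classes of a family containing a cycle are cyclically ordered by the arrows. -/
lemma exists_position (hA : IsConnectedRing A) :
    ∃ n > 0, ∃ pos : ι → ℕ, (∀ i k, IdemRel e i k ↔ pos i ≡ pos k [MOD n]) ∧
      (∀ i, pos (s i) ≡ pos i + 1 [MOD n]) ∧ ∀ i, x i ≠ 0 := by
  classical
  have hex : ∃ n, 0 < n ∧ IdemRel e i₀ (s^[n] i₀) := ⟨n, hn, hper⟩
  obtain ⟨hm, hmper⟩ := Nat.find_spec hex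
  set m := Nat.find hex
  have hiff : ∀ a b, IdemRel e (s^[a] i₀) (s^[b] i₀) ↔ a ≡ b [MOD m] := by
    refine fun a b => ⟨fun hab => ?_, h.rel_of_modEq hx hmper hne⟩
    wlog hle : a ≤ b generalizing a b
    · exact (this b a hab.symm (by omega)).symm
    have h1 : IdemRel e i₀ (s^[b - a] i₀) := by
      refine (h.rel_add_iff hx hne 0 (b - a) a).1 ?_
      rwa [zero_add, Nat.sub_add_cancel hle]
    have h2 : IdemRel e i₀ (s^[(b - a) % m] i₀) :=
      h1.trans (h.rel_of_modEq hx hmper hne (Nat.mod_modEq _ _).symm)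
    have h3 : (b - a) % m = 0 := by
      by_contra h0
      exact Nat.find_min hex (Nat.mod_lt _ hm) ⟨Nat.pos_of_ne_zero h0, h2⟩
    exact (Nat.modEq_iff_dvd' hle).2 (Nat.dvd_of_mod_eq_zero h3)
  choose pos hpos using h.exists_rel_iterate hx hn hper hne hA
  have hsucc := fun i => h.succ_rel (hx _) (hx i) (hpos i).symm (hne _)
  refine ⟨m, hm, pos, fun i k => ?_, fun i => ?_, fun i => (hsucc i).1⟩
  · rw [← hiff, ← (hpos k).congr_right]
    exact ⟨fun hik => (hpos i).symm.trans hik, fun hik => (hpos i).trans hik⟩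
  · rw [← hiff, Function.iterate_succ_apply']
    exact (hpos (s i)).symm.trans (hsucc i).2.symm

end Cyclic

end IsSerialFamily

/-! ### Dimensions of Peirce components -/

open Module in
/-- A linear map inducing an isomorphism of the quotients `E ⧸ N` and `W ⧸ W'`. -/
lemma finrank_add_finrank_of_quotient {K V₁ V₂ : Type*} [Field K] [AddCommGroup V₁] [Module K V₁]
    [AddCommGroup V₂] [Module K V₂] [FiniteDimensional K V₁] [FiniteDimensional K V₂]
    (f : V₁ →ₗ[K] V₂) {E N : Submodule K V₁} {W W' : Submodule K V₂} (hN : N ≤ E) (hW : W' ≤ W)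
    (hf : ∀ a ∈ E, f a ∈ W) (hs : ∀ w ∈ W, ∃ a ∈ E, f a = w) (hk : ∀ a ∈ E, f a ∈ W' ↔ a ∈ N) :
    finrank K W + finrank K N = finrank K W' + finrank K E := by
  let g : E →ₗ[K] W ⧸ W'.submoduleOf W := (W'.submoduleOf W).mkQ ∘ₗ (f.restrict hf)
  have hg : Function.Surjective g := by
    refine (Submodule.mkQ_surjective _).comp fun ⟨w, hw⟩ => ?_
    obtain ⟨a, ha, rfl⟩ := hs w hw
    exact ⟨⟨a, ha⟩, rfl⟩
  have hker : LinearMap.ker g = N.submoduleOf E := by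
    ext ⟨a, ha⟩
    rw [LinearMap.mem_ker, show g ⟨a, ha⟩ = Submodule.Quotient.mk ⟨f a, hf a ha⟩ from rfl,
      Submodule.Quotient.mk_eq_zero]
    exact hk a ha
  have h1 := g.finrank_range_add_finrank_ker
  rw [LinearMap.range_eq_top.2 hg, finrank_top, hker,
    (Submodule.submoduleOfEquivOfLe hN).finrank_eq] at h1
  have h2 := (W'.submoduleOf W).finrank_quotient_add_finrank
  rw [(Submodule.submoduleOfEquivOfLe hW).finrank_eq] at h2
  omega

section Layer

variable (K : Type*) {A ι : Type*} [Field K] [Ring A] [Algebra K A]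
  {V : Type*} [AddCommGroup V] [Module A V] [Module K V] [IsScalarTower K A V]

/-- The `K`-subspace `e k * A * z` of an `A`-module. -/
def layer (e : ι → A) (k : ι) (z : V) : Submodule K V where
  carrier := {y | e k • y = y ∧ ∃ a : A, y = a • z}
  zero_mem' := ⟨smul_zero _, 0, (zero_smul _ _).symm⟩
  add_mem' := by
    rintro _ _ ⟨h1, a, rfl⟩ ⟨h2, b, rfl⟩
    exact ⟨by rw [smul_add, h1, h2], a + b, (add_smul _ _ _).symm⟩
  smul_mem' := by
    rintro c _ ⟨h1, a, rfl⟩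
    exact ⟨by rw [smul_comm, h1], c • a, (smul_assoc _ _ _).symm⟩

variable {K}

lemma mem_layer {e : ι → A} {k : ι} {z y : V} :
    y ∈ layer K e k z ↔ e k • y = y ∧ ∃ a : A, y = a • z := Iff.rfl

lemma layer_smul_le (e : ι → A) (k : ι) (a : A) (z : V) :
    layer K e k (a • z) ≤ layer K e k z := by
  rintro _ ⟨h1, b, rfl⟩
  exact ⟨h1, b * a, by rw [mul_smul]⟩

end Layer

/-- The dimension of the division algebra `e i * A * e i` modulo its radical. -/
noncomputable def topDim (K : Type*) {A ι : Type*} [Field K] [Ring A] [Algebra K A] (e : ι → A)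
    (x : ι → A) (i : ι) : ℕ :=
  Module.finrank K (layer K e i (e i)) - Module.finrank K (layer K e i (x i))

namespace IsSerialFamily

open Module

variable {K A ι : Type*} [Field K] [Ring A] [Algebra K A] [FiniteDimensional K A]
  [IsArtinianRing A] [Fintype ι] {e : ι → A}
  (h : IsSerialFamily e) {s : ι → ι} {x : ι → A} (hx : ∀ i, IsArrow e i (s i) (x i))
  {V : Type*} [AddCommGroup V] [Module A V] [Module K V] [IsScalarTower K A V]
  [FiniteDimensional K V]

include h

omit [FiniteDimensional K A] [FiniteDimensional K V] [IsArtinianRing A] in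
lemma mem_layer_iff {j k : ι} {z y : V} (hz : e j • z = z) :
    y ∈ layer K e k z ↔ ∃ a, Peirce e k j a ∧ y = a • z := by
  rw [mem_layer]
  constructor
  · rintro ⟨h1, a, rfl⟩
    refine ⟨e k * a * e j, h.peirce_mk _ _ _, ?_⟩
    rw [mul_smul, hz, mul_smul, h1]
  · rintro ⟨a, ha, rfl⟩
    exact ⟨ha.smul_mem z, a, rfl⟩

include hx

omit [FiniteDimensional K A] [IsArtinianRing A] [Fintype ι] h in
lemma mem_layer_arrow_iff {k : ι} {a : A} :
    a ∈ layer K e k (x k) ↔ Peirce e k k a ∧ ¬∃ c, c * a = e k := by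
  rw [mem_layer]
  constructor
  · rintro ⟨h1, a, rfl⟩
    refine ⟨⟨h1, by rw [smul_eq_mul, mul_assoc, (hx k).peirce.2]⟩, fun ⟨c, hc⟩ => (hx k).nongen ?_⟩
    exact ⟨c * a, by rw [mul_assoc]; exact hc⟩
  · rintro ⟨ha, hn⟩
    exact ⟨ha.1, (hx k).dvd a ha.2 hn⟩

omit [FiniteDimensional K A] [IsArtinianRing A] [Fintype ι] h in
lemma layer_arrow_le (k : ι) : layer K e k (x k) ≤ layer K e k (e k) := by
  conv_lhs => rw [← (hx k).peirce.2]
  exact layer_smul_le e k (x k) (e k)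

omit [IsArtinianRing A] [Fintype ι] h in
-- The truncated subtraction in `topDim` loses nothing.
lemma finrank_layer_idem (k : ι) :
    finrank K (layer K e k (e k)) = finrank K (layer K e k (x k)) + topDim K e x k := by
  have := Submodule.finrank_mono (layer_arrow_le (K := K) hx k)
  rw [topDim]
  omega

open Classical in
-- Passing from `A z` to `A (x j • z)` removes the simple top of `A z`, which is visible to `e k`
-- only when `z ≠ 0` and `e k` is isomorphic to `e j`.
lemma finrank_layer {j k : ι} {z : V} (hz : e j • z = z) :
    finrank K (layer K e k z) = finrank K (layer K e k (x j • z)) +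
      if z ≠ 0 ∧ IdemRel e j k then topDim K e x k else 0 := by
  split_ifs with hc
  · obtain ⟨hz0, v, u, hv, hu, huv, hvu⟩ := hc
    let f : A →ₗ[K] V :=
      { toFun := fun a => (a * v) • z
        map_add' := fun a b => by rw [add_mul, add_smul]
        map_smul' := fun c a => by rw [smul_mul_assoc, smul_assoc, RingHom.id_apply] }
    have := finrank_add_finrank_of_quotient f (E := layer K e k (e k)) (N := layer K e k (x k))
      (W := layer K e k z) (W' := layer K e k (x j • z)) (layer_arrow_le hx k)
      (layer_smul_le e k (x j) z) ?_ ?_ ?_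
    · rw [finrank_layer_idem hx] at this
      omega
    · intro a ha
      obtain ⟨b, hb, rfl⟩ := (h.mem_layer_iff (h.idem k)).1 ha
      rw [smul_eq_mul, hb.2]
      exact (h.mem_layer_iff hz).2 ⟨b * v, hb.mul hv, rfl⟩
    · intro y hy
      obtain ⟨b, hb, rfl⟩ := (h.mem_layer_iff hz).1 hy
      refine ⟨b * u, (h.mem_layer_iff (h.idem k)).2 ⟨b * u, hb.mul hu, ((hb.mul hu).2).symm⟩, ?_⟩
      change (b * u * v) • z = b • z
      rw [mul_assoc, huv, hb.2]
    · intro a ha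
      obtain ⟨b, hb, rfl⟩ := (h.mem_layer_iff (h.idem k)).1 ha
      rw [smul_eq_mul, hb.2, mem_layer_arrow_iff hx]
      change (b * v) • z ∈ _ ↔ _
      constructor
      · refine fun hbv => ⟨hb, fun hg => hz0 ?_⟩
        obtain ⟨-, c, hc⟩ := hbv
        obtain ⟨b', hb', h1, -⟩ := h.iso_of_left hb hg
        have h2 : (u * b' * c * x j * e j) • z = z := by
          rw [mul_smul, hz, mul_smul, mul_smul, ← hc, ← mul_smul, mul_assoc, ← mul_assoc b', h1,
            hv.1, huv, hz]
        refine (h.isNilpotent ⟨?_, by rw [mul_assoc, h.idem]⟩ ?_).eq_zero_of_smul_eq h2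
        · simp only [← mul_assoc, hu.1]
        · rintro ⟨d, hd⟩
          refine (hx j).nongen ⟨d * (u * b' * c), ?_⟩
          rw [← hd, mul_assoc _ (x j), (hx j).peirce.2, mul_assoc, mul_assoc, mul_assoc]
      · rintro ⟨-, hg⟩
        obtain ⟨c, hc⟩ := (hx j).dvd (b * v) (hb.mul hv).2 (fun hg' => hg (h.gen_of_mul hb.2 hv hg'))
        exact ⟨(hb.mul hv).smul_mem z, c, by rw [hc, mul_smul]⟩
  · rw [add_zero]
    suffices hl : layer K e k z = layer K e k (x j • z) by rw [← hl]
    refine le_antisymm (fun y hy => ?_) (layer_smul_le _ _ _ _)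
    obtain ⟨b, hb, rfl⟩ := (h.mem_layer_iff hz).1 hy
    by_cases hz0 : z = 0
    · subst hz0
      rwa [smul_zero]
    · obtain ⟨c, hc'⟩ := (hx j).dvd b hb.2 fun hg => hc ⟨hz0, h.rel_of_left hb hg⟩
      exact ⟨hb.smul_mem z, c, by rw [hc', mul_smul]⟩

/-- The quotient of `e k * A * e i` by `e k * A * x i` is measured twice: by `finrank_layer`, and by
left multiplication with `u` from the corner at `i`. -/
lemma topDim_eq_of_rel {i k : ι} (hik : IdemRel e i k) :
    topDim K e x i = topDim K e x k := by
  classical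
  have h1 := h.finrank_layer (K := K) hx (j := i) (k := k) (z := e i) (h.idem i)
  rw [if_pos ⟨h.ne_zero i, hik⟩, smul_eq_mul, (hx i).peirce.2] at h1
  obtain ⟨u, v, hu, hv, hvu, huv⟩ := hik
  have := finrank_add_finrank_of_quotient (LinearMap.mulLeft K u) (E := layer K e i (e i))
    (N := layer K e i (x i)) (W := layer K e k (e i)) (W' := layer K e k (x i))
    (layer_arrow_le hx i) ?_ ?_ ?_ ?_
  · rw [finrank_layer_idem hx] at this
    omega
  · conv_lhs => rw [← (hx i).peirce.2]
    exact layer_smul_le e k (x i) (e i)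
  · rintro _ ⟨-, b, rfl⟩
    exact ⟨hu.smul_mem (V := A) _, u * b, by rw [LinearMap.mulLeft_apply, smul_eq_mul, smul_eq_mul,
      mul_assoc]⟩
  · rintro _ ⟨hk, b, rfl⟩
    refine ⟨v * b * e i, ⟨?_, v * b, rfl⟩, ?_⟩
    · simp only [smul_eq_mul, ← mul_assoc, hv.1]
    · rw [smul_eq_mul, smul_eq_mul] at hk
      rw [LinearMap.mulLeft_apply, smul_eq_mul, ← mul_assoc, ← mul_assoc, huv, mul_assoc, hk]
  · rintro a ⟨ha, -⟩
    rw [LinearMap.mulLeft_apply]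
    constructor
    · rintro ⟨-, c, hc⟩
      exact ⟨ha, v * c, by rw [mul_smul, ← hc, smul_eq_mul, ← mul_assoc, hvu]; exact ha.symm⟩
    · rintro ⟨-, c, hc⟩
      exact ⟨hu.smul_mem (V := A) _, u * c, by rw [hc, smul_eq_mul, smul_eq_mul, mul_assoc]⟩

/-- The top of `A * x i` is measured from the corner at `s i` by `finrank_layer`, and from the
corner at `i` by left multiplication with `x i`. The latter is onto because a nonzero arrow
generates the right radical too (`IsArrow.dvd_right`). -/
lemma topDim_succ {i : ι} (hx0 : x i ≠ 0) : topDim K e x (s i) = topDim K e x i := by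
  classical
  have h1 := h.finrank_layer (K := K) hx (j := s i) (k := s i) (z := x i) (hx i).peirce.1
  rw [if_pos ⟨hx0, h.rel_refl _⟩, smul_eq_mul] at h1
  have hleft : ∀ c, ∃ d, x i * c * x i = d * (x (s i) * x i) := fun c => by
    have hp : Peirce e (s i) (s i) (x i * c * e (s i)) :=
      ⟨by rw [← mul_assoc, ← mul_assoc, (hx i).peirce.1], by rw [mul_assoc, h.idem]⟩
    obtain ⟨d, hd⟩ := (hx (s i)).dvd (x i * c * e (s i)) hp.2 fun hg => by
      obtain ⟨b, -, -, hb⟩ := h.iso_of_left hp hg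
      obtain ⟨b', -, hb', -⟩ := h.iso_of_right (hx i).peirce
        ⟨c * e (s i) * b, by simpa only [mul_assoc] using hb⟩
      exact (hx i).nongen ⟨b', hb'⟩
    exact ⟨d, by rw [← mul_assoc, ← hd, mul_assoc _ (e (s i)), (hx i).peirce.1]⟩
  have := finrank_add_finrank_of_quotient (LinearMap.mulLeft K (x i)) (E := layer K e i (e i))
    (N := layer K e i (x i)) (W := layer K e (s i) (x i)) (W' := layer K e (s i) (x (s i) * x i))
    (layer_arrow_le hx i) (layer_smul_le e (s i) (x (s i)) (x i)) ?_ ?_ ?_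
  · rw [finrank_layer_idem hx] at this
    omega
  · rintro a ha
    obtain ⟨b, hb, rfl⟩ := (h.mem_layer_iff (h.idem i)).1 ha
    rw [smul_eq_mul, hb.2, LinearMap.mulLeft_apply]
    refine ⟨(hx i).peirce.smul_mem (V := A) b, (hx i).dvd _ (by rw [mul_assoc, hb.2]) fun hg => ?_⟩
    exact (hx i).nongen (h.gen_of_mul (hx i).peirce.2 hb hg)
  · rintro _ ⟨hk, b, rfl⟩
    have hp : Peirce e (s i) i (b • x i) := ⟨hk, by rw [smul_eq_mul, mul_assoc, (hx i).peirce.2]⟩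
    obtain ⟨c, hc⟩ := (hx i).dvd_right h hx0 (a := b • x i) hk fun hg => by
      obtain ⟨b', -, hb', -⟩ := h.iso_of_right hp hg
      exact (hx i).nongen ⟨b' * b, by rw [mul_assoc]; exact hb'⟩
    refine ⟨e i * c * e i, (h.mem_layer_iff (h.idem i)).2 ⟨_, h.peirce_mk i i c,
      (h.peirce_mk i i c).2.symm⟩, ?_⟩
    rw [LinearMap.mulLeft_apply, ← mul_assoc, ← mul_assoc, (hx i).peirce.2, ← hc, hp.2]
  · rintro a ha
    obtain ⟨b, hb, rfl⟩ := (h.mem_layer_iff (h.idem i)).1 ha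
    rw [smul_eq_mul, hb.2, LinearMap.mulLeft_apply, mem_layer_arrow_iff hx]
    constructor
    · rintro ⟨-, c, hc⟩
      refine ⟨hb, fun hg => hx0 ?_⟩
      obtain ⟨b', hb', -, h2⟩ := h.iso_of_left hb hg
      obtain ⟨d, hd⟩ := (hx i).dvd (x i * b') (by rw [mul_assoc, hb'.2]) fun hg' =>
        (hx i).nongen (h.gen_of_mul (hx i).peirce.2 hb' hg')
      have h3 : (e (s i) * c * x (s i) * (e (s i) * d * e (s i))) * x i = x i := by
        have h4 : e (s i) * d * e (s i) * x i = x i * b' := by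
          rw [mul_assoc, (hx i).peirce.1, mul_assoc, ← hd, ← mul_assoc, (hx i).peirce.1]
        rw [mul_assoc, h4, mul_assoc (e (s i)), mul_assoc (e (s i)), mul_assoc c, ← mul_assoc (x _),
          ← mul_assoc c, ← smul_eq_mul c, ← hc, mul_assoc, h2, (hx i).peirce.2, (hx i).peirce.1]
      refine (h.isNilpotent (i := s i) ⟨?_, ?_⟩ ?_).eq_zero_of_smul_eq h3
      · simp only [← mul_assoc, h.idem]
      · simp only [mul_assoc, h.idem]
      · rintro ⟨q, hq⟩
        obtain ⟨r, hr⟩ := h.gen_of_mul (a := e (s i) * c * x (s i))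
          (by rw [mul_assoc, (hx (s i)).peirce.2])
          (⟨by simp only [← mul_assoc, h.idem], by rw [mul_assoc, h.idem]⟩ :
            Peirce e (s i) (s i) (e (s i) * d * e (s i))) ⟨q, hq⟩
        exact (hx (s i)).nongen ⟨r * (e (s i) * c), by rw [mul_assoc]; exact hr⟩
    · rintro ⟨-, hg⟩
      obtain ⟨c, rfl⟩ := (hx i).dvd b hb.2 hg
      obtain ⟨d, hd⟩ := hleft c
      refine ⟨(hx i).peirce.smul_mem (V := A) _, d, ?_⟩
      rw [← mul_assoc, hd, smul_eq_mul]

open Classical in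
/-- Dimensions of Peirce components of the radical layers of a uniserial module of length `m`. -/
lemma finrank_layer_path {d : ℕ} (hd : ∀ i, topDim K e x i = d) {i k : ι} {v : V}
    {m : ℕ} (hm : arrowPath e s x i m • v = 0) (hlt : ∀ t < m, arrowPath e s x i t • v ≠ 0)
    (t : ℕ) : finrank K (layer K e k (arrowPath e s x i t • v)) =
      d * ((Finset.Ico t m).filter fun j => IdemRel e (s^[j] i) k).card := by
  by_cases htm : m ≤ t
  · obtain ⟨r, rfl⟩ := Nat.exists_eq_add_of_le' htm
    rw [Finset.Ico_eq_empty (by omega), ← h.path_add hx, mul_smul, hm, smul_zero]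
    have : layer K e k (0 : V) = ⊥ := by
      rw [eq_bot_iff]
      rintro _ ⟨-, a, rfl⟩
      exact smul_zero a
    rw [this]
    simp
  · replace htm : t ≤ m := by omega
    induction htm using Nat.decreasingInduction with
    | self =>
      rw [Finset.Ico_self, hm]
      have : layer K e k (0 : V) = ⊥ := by
        rw [eq_bot_iff]
        rintro _ ⟨-, a, rfl⟩
        exact smul_zero a
      rw [this]
      simp
    | of_succ t htm ih =>
      rw [h.finrank_layer hx (j := s^[t] i) ((h.path_peirce hx i t).smul_mem v), ← mul_smul,
        ← arrowPath, ih, ← Finset.insert_Ico_add_one_left_eq_Ico htm, Finset.filter_insert, hd]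
      by_cases hr : IdemRel e (s^[t] i) k
      · rw [if_pos ⟨hlt t htm, hr⟩, if_pos hr, Finset.card_insert_of_notMem (by simp)]
        ring
      · rw [if_neg (fun hc => hr hc.2), if_neg hr, add_zero]

end IsSerialFamily

/-! ### Modules given by top and length -/

/-- The element `v` generates the module `V`, lies in `e i • V`, and `V` has length `m`. -/
structure HasTop {A ι V : Type*} [Ring A] [AddCommGroup V] [Module A V] (e : ι → A) (s : ι → ι)
    (x : ι → A) (i : ι) (m : ℕ) (v : V) : Prop where
  idem_smul : e i • v = v
  generates : ∀ y : V, ∃ a : A, y = a • v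
  path_smul_eq_zero : arrowPath e s x i m • v = 0
  path_smul_ne_zero : ∀ t < m, arrowPath e s x i t • v ≠ 0

namespace HasTop

variable {A ι : Type*} [Ring A] {e : ι → A} {s : ι → ι} {x : ι → A}
  {V : Type*} [AddCommGroup V] [Module A V] {i : ι} {m : ℕ} {v : V}

lemma map_ext (hv : HasTop e s x i m v) {W : Type*} [AddCommGroup W] [Module A W]
    {f g : V →ₗ[A] W} (hfg : f v = g v) : f = g := by
  ext y
  obtain ⟨a, rfl⟩ := hv.generates y
  rw [map_smul, map_smul, hfg]

lemma finiteDimensional (hv : HasTop e s x i m v) (K : Type*) [Field K] [Algebra K A]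
    [FiniteDimensional K A] [Module K V] [IsScalarTower K A V] : FiniteDimensional K V :=
  Module.Finite.of_surjective ((LinearMap.toSpanSingleton A V v).restrictScalars K) fun y => by
    obtain ⟨a, rfl⟩ := hv.generates y
    exact ⟨a, rfl⟩

variable [IsArtinianRing A] [Fintype ι] (h : IsSerialFamily e)
  (hx : ∀ i, IsArrow e i (s i) (x i))

include h hx

lemma exists_length (hv : e i • v = v) (hgen : ∀ y : V, ∃ a : A, y = a • v) :
    ∃ m, HasTop e s x i m v := by
  classical
  have hex : ∃ m, arrowPath e s x i m • v = 0 := by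
    obtain ⟨m, hm⟩ := h.exists_path_eq_zero hx i
    exact ⟨m, by rw [hm, zero_smul]⟩
  exact ⟨Nat.find hex, hv, hgen, Nat.find_spec hex, fun t ht => Nat.find_min hex ht⟩

omit [IsArtinianRing A] in
lemma path_smul_eq_zero_iff (hv : HasTop e s x i m v) {t : ℕ} :
    arrowPath e s x i t • v = 0 ↔ m ≤ t := by
  constructor
  · intro ht
    by_contra hlt
    exact hv.path_smul_ne_zero t (by omega) ht
  · intro ht
    obtain ⟨r, rfl⟩ := Nat.exists_eq_add_of_le' ht
    rw [← h.path_add hx, mul_smul, hv.path_smul_eq_zero, smul_zero]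

/-- The annihilator of the generator is generated by a path. -/
lemma smul_eq_zero_iff (hv : HasTop e s x i m v) {a : A} (ha : a * e i = a) :
    a • v = 0 ↔ ∃ c, a = c * arrowPath e s x i m := by
  constructor
  · intro hav
    have key : ∀ k, ∃ c, e k * a = c * arrowPath e s x i m := fun k => by
      by_cases h0 : e k * a = 0
      · exact ⟨0, by rw [h0, zero_mul]⟩
      obtain ⟨t, c, hc, ⟨d, hd⟩, hac⟩ := h.exists_eq_mul_path hx
        (i := i) (k := k) ⟨by rw [← mul_assoc, h.idem], by rw [mul_assoc, ha]⟩ h0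
      have ht : arrowPath e s x i t • v = 0 := by
        rw [← (h.path_peirce hx i t).1, ← hd, mul_assoc, ← hac, mul_smul, mul_smul, hav,
          smul_zero, smul_zero]
      obtain ⟨r, rfl⟩ := Nat.exists_eq_add_of_le' ((hv.path_smul_eq_zero_iff h hx).1 ht)
      exact ⟨c * arrowPath e s x (s^[m] i) r, by rw [hac, mul_assoc, h.path_add hx]⟩
    choose c hc using key
    refine ⟨∑ k, c k, ?_⟩
    rw [Finset.sum_mul, ← Finset.sum_congr rfl fun j _ => hc j, ← Finset.sum_mul,
      h.complete.complete, one_mul]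
  · rintro ⟨c, rfl⟩
    rw [mul_smul, hv.path_smul_eq_zero, smul_zero]

/-- Elements of `e k • V` are multiples of paths with an invertible cofactor. -/
lemma exists_eq_smul_path (hv : HasTop e s x i m v) {k : ι} {y : V} (hy : e k • y = y)
    (hy0 : y ≠ 0) : ∃ t < m, ∃ c d, Peirce e k (s^[t] i) c ∧ Peirce e (s^[t] i) k d ∧
      d * c = e (s^[t] i) ∧ c * d = e k ∧ y = c • arrowPath e s x i t • v := by
  obtain ⟨a, ha⟩ := hv.generates y
  have ha' : y = (e k * a * e i) • v := by
    rw [mul_smul, hv.idem_smul, mul_smul, ← ha, hy]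
  obtain ⟨t, c, hc, hg, hac⟩ := h.exists_eq_mul_path hx (h.peirce_mk k i a)
    (fun h0 => hy0 (by rw [ha', h0, zero_smul]))
  obtain ⟨d, hd, h1, h2⟩ := h.iso_of_left hc hg
  have hyc : y = c • arrowPath e s x i t • v := by rw [ha', hac, mul_smul]
  refine ⟨t, ?_, c, d, hc, hd, h1, h2, hyc⟩
  by_contra hlt
  exact hy0 (by rw [hyc, (hv.path_smul_eq_zero_iff h hx).2 (by omega), smul_zero])

lemma rel_of_smul_eq (hv : HasTop e s x i m v) {k : ι} {y : V} (hy : e k • y = y)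
    (hy0 : y ≠ 0) : ∃ t < m, IdemRel e (s^[t] i) k := by
  obtain ⟨t, ht, c, d, hc, hd, h1, h2, -⟩ := hv.exists_eq_smul_path h hx hy hy0
  exact ⟨t, ht, c, d, hc, hd, h1, h2⟩

/-- The elements of `e b • V` annihilated by a path of length `l` are those in the `l`-th layer
of the socle filtration. -/
lemma mem_layer_sub_iff {K : Type*} [Field K] [Algebra K A] [Module K V] [IsScalarTower K A V]
    (hv : HasTop e s x i m v) {b : ι} {l : ℕ} {y : V} :
    y ∈ layer K e b (arrowPath e s x i (m - l) • v) ↔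
      e b • y = y ∧ arrowPath e s x b l • y = 0 := by
  constructor
  · intro hy
    refine ⟨hy.1, ?_⟩
    obtain ⟨a, ha, rfl⟩ :=
      (h.mem_layer_iff ((h.path_peirce hx i (m - l)).smul_mem v)).1 hy
    obtain ⟨c, -, hc⟩ := h.path_comm hx ha l
    rw [← mul_smul, hc, mul_smul, ← mul_smul _ _ v, h.path_add hx,
      (hv.path_smul_eq_zero_iff h hx).2 (by omega), smul_zero]
  · rintro ⟨hy, hl⟩
    by_cases hy0 : y = 0
    · rw [hy0]
      exact zero_mem _
    obtain ⟨t, ht, c, d, hc, hd, h1, h2, hyc⟩ := hv.exists_eq_smul_path h hx hy hy0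
    obtain ⟨d', -, hd'⟩ := h.path_comm hx hd l
    have h3 : arrowPath e s x i (l + t) • v = 0 := by
      rw [← h.path_add hx, ← (h.path_peirce hx (s^[t] i) l).2, ← h1, ← mul_assoc, hd', mul_smul,
        mul_smul, ← hyc, mul_smul, hl, smul_zero]
    have h4 := (hv.path_smul_eq_zero_iff h hx).1 h3
    obtain ⟨r, rfl⟩ := Nat.exists_eq_add_of_le' (show m - l ≤ t by omega)
    exact ⟨hy, c * arrowPath e s x (s^[m - l] i) r, by
      rw [hyc, ← h.path_add hx, mul_smul, mul_smul]⟩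

/-- Homomorphisms out of `V` can be prescribed on the generator. -/
lemma exists_map (hv : HasTop e s x i m v) {W : Type*} [AddCommGroup W] [Module A W] {y : W}
    (hy : e i • y = y) (hm : arrowPath e s x i m • y = 0) : ∃ f : V →ₗ[A] W, f v = y := by
  have hle : LinearMap.ker (LinearMap.toSpanSingleton A V v) ≤
      LinearMap.ker (LinearMap.toSpanSingleton A W y) := fun a ha => by
    rw [LinearMap.mem_ker, LinearMap.toSpanSingleton_apply] at ha ⊢
    obtain ⟨c, hc⟩ := (hv.smul_eq_zero_iff h hx (a := a * e i) (by rw [mul_assoc, h.idem])).1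
      (by rw [mul_smul, hv.idem_smul, ha])
    rw [← hy, ← mul_smul, hc, mul_smul, hm, smul_zero]
  have hsurj : Function.Surjective (LinearMap.toSpanSingleton A V v) := fun y => by
    obtain ⟨a, rfl⟩ := hv.generates y
    exact ⟨a, rfl⟩
  refine ⟨(LinearMap.ker (LinearMap.toSpanSingleton A V v)).liftQ _ hle ∘ₗ
    ((LinearMap.toSpanSingleton A V v).quotKerEquivOfSurjective hsurj).symm.toLinearMap, ?_⟩
  have : ((LinearMap.toSpanSingleton A V v).quotKerEquivOfSurjective hsurj).symm v =
      Submodule.Quotient.mk 1 := by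
    rw [LinearEquiv.symm_apply_eq]
    exact (one_smul A v).symm
  rw [LinearMap.comp_apply, LinearEquiv.coe_coe, this]
  exact one_smul A y

/-- If the radical layer following the socle of `V` occurs in `V`, the arrows are cyclic. -/
lemma exists_periodic (hv : HasTop e s x i m v) (hm : arrowPath e s x i m ≠ 0) {y : V}
    (hy : e (s^[m] i) • y = y) (hy0 : y ≠ 0) :
    ∃ n > 0, ∃ i₀, IdemRel e i₀ (s^[n] i₀) ∧ ∀ t, x (s^[t] i₀) ≠ 0 := by
  obtain ⟨t, ht, hrel⟩ := hv.rel_of_smul_eq h hx hy hy0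
  -- The class at position `m`, just past the socle, already occurs at position `t < m`, which gives
  -- the period `m - t`.
  have hper : IdemRel e (s^[t] i) (s^[m - t] (s^[t] i)) := by
    rwa [← Function.iterate_add_apply, Nat.sub_add_cancel ht.le]
  refine ⟨m - t, by omega, s^[t] i, hper, h.ne_zero_of_periodic hx (by omega) hper fun r hr => ?_⟩
  rw [← Function.iterate_add_apply]
  exact h.arrow_ne_zero hx hm (by omega)

/-- The image of `e i • V` under a path of length `l`. -/
lemma path_smul_mem_layer {K : Type*} [Field K] [Algebra K A] [Module K V] [IsScalarTower K A V]
    (hv : HasTop e s x i m v) {k : ι} {j l : ℕ} (hj : ∀ t, IdemRel e (s^[t] i) k → j ≤ t) {y : V}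
    (hy : e k • y = y) :
    arrowPath e s x k l • y ∈ layer K e (s^[l] k) (arrowPath e s x i (l + j) • v) := by
  by_cases hy0 : y = 0
  · rw [hy0, smul_zero]
    exact zero_mem _
  obtain ⟨t, ht, c, d, hc, hd, h1, h2, hyc⟩ := hv.exists_eq_smul_path h hx hy hy0
  obtain ⟨r, rfl⟩ := Nat.exists_eq_add_of_le' (hj t ⟨c, d, hc, hd, h1, h2⟩)
  obtain ⟨c', -, hc'⟩ := h.path_comm hx hc l
  refine ⟨(h.path_peirce hx k l).smul_mem y, c' * arrowPath e s x (s^[l + j] i) r, ?_⟩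
  rw [hyc, ← mul_smul, hc', mul_smul, ← mul_smul _ _ v, h.path_add hx, mul_smul,
    ← mul_smul (arrowPath e s x (s^[l + j] i) r), h.path_add hx, show l + (r + j) = r + (l + j) by omega]

end HasTop

/-! ### Residue classes in intervals -/

section Count

lemma le_card_filter_modEq {n a b c r : ℕ} (hn : 0 < n) (h : a + r * n ≤ b) :
    r ≤ ((Finset.Ico a b).filter fun j => j ≡ c [MOD n]).card := by
  obtain ⟨j₀, hj₀, hj₁, hj₂⟩ : ∃ j₀, a ≤ j₀ ∧ j₀ < a + n ∧ j₀ ≡ c [MOD n] := by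
    -- Here `(n - 1) * a` plays the role of `-a` modulo `n`, avoiding truncated subtraction.
    refine ⟨a + (c + (n - 1) * a) % n, by omega, by have := Nat.mod_lt (c + (n - 1) * a) hn; omega,
      ?_⟩
    have h1 : a + (c + (n - 1) * a) % n ≡ a + (c + (n - 1) * a) [MOD n] :=
      (Nat.mod_modEq _ _).add_left a
    refine h1.trans ?_
    have h2 : a + (c + (n - 1) * a) = c + n * a := by
      obtain ⟨n, rfl⟩ := Nat.exists_eq_succ_of_ne_zero hn.ne'
      simp only [Nat.succ_eq_add_one, Nat.add_sub_cancel]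
      ring
    rw [h2]
    simp [Nat.ModEq]
  have hinj : Function.Injective fun q : ℕ => j₀ + q * n := fun q q' hq => by
    simpa [hn.ne'] using hq
  calc r = ((Finset.range r).image fun q => j₀ + q * n).card := by
        rw [Finset.card_image_of_injective _ hinj, Finset.card_range]
    _ ≤ _ := Finset.card_le_card fun j hj => by
        obtain ⟨q, hq, rfl⟩ := Finset.mem_image.1 hj
        have : (q + 1) * n ≤ r * n := Nat.mul_le_mul_right n (Finset.mem_range.1 hq)
        rw [add_mul, one_mul] at this
        refine Finset.mem_filter.2 ⟨Finset.mem_Ico.2 ⟨by omega, by omega⟩, ?_⟩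
        refine Nat.ModEq.trans ?_ hj₂
        simp [Nat.ModEq]

/-- The elements are `b - n, b - 2n, …`, so each uses up a full block of length `n`. For a residue
other than that of the excluded end `b`, the count could be larger by one. -/
lemma card_filter_modEq_self_mul_le {n a b : ℕ} :
    ((Finset.Ico a b).filter fun j => j ≡ b [MOD n]).card * n ≤ b - a := by
  rcases Nat.eq_zero_or_pos n with rfl | hn
  · simp
  rw [← Nat.le_div_iff_mul_le hn]
  calc _ ≤ (Finset.Icc 1 ((b - a) / n)).card := by
        refine Finset.card_le_card_of_injOn (fun j => (b - j) / n) (fun j hj => ?_)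
          fun j hj j' hj' hjj' => ?_
        · obtain ⟨hj1, hj2⟩ := Finset.mem_filter.1 hj
          rw [Finset.mem_Ico] at hj1
          obtain ⟨q, hq⟩ := (Nat.modEq_iff_dvd' hj1.2.le).1 hj2
          refine Finset.mem_coe.2 (Finset.mem_Icc.2 ⟨?_, Nat.div_le_div_right (by omega)⟩)
          exact (Nat.le_div_iff_mul_le hn).2 (by rw [one_mul]; exact Nat.le_of_dvd (by omega) ⟨q, hq⟩)
        · obtain ⟨hj1, hj2⟩ := Finset.mem_filter.1 hj
          obtain ⟨hj1', hj2'⟩ := Finset.mem_filter.1 hj'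
          rw [Finset.mem_Ico] at hj1 hj1'
          obtain ⟨q, hq⟩ := (Nat.modEq_iff_dvd' hj1.2.le).1 hj2
          obtain ⟨q', hq'⟩ := (Nat.modEq_iff_dvd' hj1'.2.le).1 hj2'
          simp only [hq, hq', Nat.mul_div_cancel_left _ hn] at hjj'
          subst hjj'
          omega
    _ = _ := by simp

end Count

/-! ### Indecomposable modules are cyclic -/

namespace IsSerialFamily

variable {A ι : Type*} [Ring A] [IsArtinianRing A] [Fintype ι] {e : ι → A}
  (h : IsSerialFamily e) {s : ι → ι} {x : ι → A} (hx : ∀ i, IsArrow e i (s i) (x i))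
  {V : Type*} [AddCommGroup V] [Module A V]

include h hx

/-- In a module with an essential simple socle generated by `σ`, cyclic submodules generated by
elements of the `e i • V` are comparable. -/
lemma exists_smul_eq_or {b : ι} {σ : V} (hσ : e b • σ = σ) (hσ0 : σ ≠ 0)
    (hess : ∀ y : V, y ≠ 0 → ∃ a : A, a • y = σ) (n : ℕ) :
    ∀ {i k : ι} {m m' : ℕ} {y z : V}, m + m' ≤ n → e i • y = y → e k • z = z →
      arrowPath e s x i m • y = 0 → arrowPath e s x k m' • z = 0 →
      (∃ a : A, y = a • z) ∨ ∃ a : A, z = a • y := by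
  induction n using Nat.strong_induction_on with
  | _ n ih =>
  -- Reach `σ` from `y` by `a` and from `z` by `a'`. When `a = a' * c`, subtracting `e k • c • y`
  -- from `z` leaves an element killed by a path of length `t < m'`, to which the induction applies.
  have aux : ∀ {i k : ι} {m m' : ℕ} {y z : V} {a a' c : A}, m + m' ≤ n → e i • y = y →
      e k • z = z → arrowPath e s x i m • y = 0 → arrowPath e s x k m' • z = 0 →
      Peirce e b k a' → a • y = σ → a' • z = σ → a = a' * c →
      (∃ a : A, y = a • z) ∨ ∃ a : A, z = a • y := by
    intro i k m m' y z a a' c hmn hy hz hym hzm ha' hay haz hac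
    have ha'0 : a' ≠ 0 := by
      rintro rfl
      exact hσ0 (by rw [← haz, zero_smul])
    obtain ⟨t, d, hd, ⟨d', hd'⟩, had⟩ := h.exists_eq_mul_path hx ha' ha'0
    have hp := h.path_peirce hx k t
    have hpath : arrowPath e s x k t = d' * a' := by rw [had, ← mul_assoc, hd', hp.1]
    have hz0 : a' • (z - e k • c • y) = 0 := by
      rw [smul_sub, haz, ← mul_smul a', ha'.2, ← mul_smul, ← hac, hay, sub_self]
    have htz : arrowPath e s x k t • (z - e k • c • y) = 0 := by
      rw [hpath, mul_smul, hz0, smul_zero]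
    have htne : arrowPath e s x k t • z ≠ 0 := fun h0 => hσ0 <| by
      rw [← haz, had, mul_smul, h0, smul_zero]
    have htm : t < m' := by
      by_contra hle
      obtain ⟨r, rfl⟩ := Nat.exists_eq_add_of_le' (not_lt.1 hle)
      exact htne (by rw [← h.path_add hx, mul_smul, hzm, smul_zero])
    rcases ih (m + t) (by omega) le_rfl hy
      (show e k • (z - e k • c • y) = _ by rw [smul_sub, hz, ← mul_smul (e k), h.idem]) hym htz
      with ⟨g, hg⟩ | ⟨g, hg⟩
    -- If `y` were a multiple of the difference `z'`, so would be `z`, and the path of length `t`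
    -- would kill `z`.
    · exfalso
      set z' := z - e k • c • y with hz'
      have hek : e k • z' = z' := by rw [hz', smul_sub, hz, ← mul_smul (e k), h.idem]
      have hzz : z = (e k * (1 + c * g) * e k) • z' := by
        rw [mul_smul, hek, mul_smul, add_smul, one_smul, mul_smul, ← hg, smul_add, hek, hz',
          sub_add_cancel]
      obtain ⟨q, -, hq⟩ := h.path_comm hx (h.peirce_mk k k (1 + c * g)) t
      exact htne (by rw [hzz, ← mul_smul, hq, mul_smul, htz, smul_zero])
    · exact .inr ⟨g + e k * c, by rw [add_smul, ← hg, mul_smul, sub_add_cancel]⟩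
  intro i k m m' y z hmn hy hz hym hzm
  by_cases hy0 : y = 0
  · exact .inl ⟨0, by rw [hy0, zero_smul]⟩
  by_cases hz0 : z = 0
  · exact .inr ⟨0, by rw [hz0, zero_smul]⟩
  have hcorner : ∀ {i : ι} {y : V}, e i • y = y → y ≠ 0 → ∃ a, Peirce e b i a ∧ a • y = σ := by
    intro i y hy hy0
    obtain ⟨a, ha⟩ := hess y hy0
    exact ⟨_, h.peirce_mk b i a, by rw [mul_smul, hy, mul_smul, ha, hσ]⟩
  obtain ⟨a, ha, hay⟩ := hcorner hy hy0
  obtain ⟨a', ha', haz⟩ := hcorner hz hz0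
  rcases h.right_total b a a' ha.1 ha'.1 with ⟨c, hc⟩ | ⟨c, hc⟩
  · exact aux hmn hy hz hym hzm ha' hay haz hc
  · exact (aux (by omega) hz hy hzm hym ha haz hay hc).symm

/-- Every nonzero module has a direct summand generated by an element of some `e i • V`. -/
lemma exists_isCompl_span [Nontrivial V] : ∃ (i : ι) (v : V) (C : Submodule A V),
    e i • v = v ∧ v ≠ 0 ∧ IsCompl (Submodule.span A {v}) C := by
  classical
  -- Choose `v` of the largest length `n + 1` and let `σ` span its socle.
  have hex : ∃ m, ∀ k (z : V), e k • z = z → arrowPath e s x k m • z = 0 := by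
    obtain ⟨L, hL⟩ := h.exists_forall_path_eq_zero hx
    exact ⟨L, fun k z _ => by rw [hL, zero_smul]⟩
  obtain ⟨n, hn⟩ : ∃ n, Nat.find hex = n + 1 := Nat.exists_eq_succ_of_ne_zero fun h0 => by
    obtain ⟨v, hv⟩ := exists_ne (0 : V)
    obtain ⟨k, hk⟩ := h.exists_smul_ne_zero hv
    have h1 := Nat.find_spec hex k (e k • v) (by rw [← mul_smul, h.idem])
    rw [h0, arrowPath, ← mul_smul, h.idem] at h1
    exact hk h1
  have hmax := Nat.find_spec hex
  rw [hn] at hmax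
  have hmin := Nat.find_min hex (m := n) (by omega)
  push Not at hmin
  obtain ⟨i, v, hv, hσ0⟩ := hmin
  set σ := arrowPath e s x i n • v with hσdef
  have hσ : e (s^[n] i) • σ = σ := (h.path_peirce hx i n).smul_mem v
  -- Maximality of `C` among submodules avoiding `σ` makes the image of `σ` generate an essential
  -- simple socle of `V ⧸ C`. Then `exists_smul_eq_or` compares every homogeneous `z` with `v`
  -- modulo `C`.
  obtain ⟨C, -, hC⟩ := zorn_le_nonempty₀ {C : Submodule A V | σ ∉ C} (fun c hc hchain y hy => by
    refine ⟨sSup c, fun hmem => ?_, fun z hz => le_sSup hz⟩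
    obtain ⟨D, hD, hmem⟩ := (Submodule.mem_sSup_of_directed ⟨y, hy⟩ hchain.directedOn).1 hmem
    exact hc hD hmem) ⊥ (by simpa using hσ0)
  have hCσ : σ ∉ C := hC.prop
  have hess : ∀ y : V ⧸ C, y ≠ 0 → ∃ a : A, a • y = C.mkQ σ := by
    intro y hy
    obtain ⟨y, rfl⟩ := C.mkQ_surjective y
    have hyC : y ∉ C := fun hyC => hy ((Submodule.Quotient.mk_eq_zero C).2 hyC)
    have hmem : σ ∈ C ⊔ Submodule.span A {y} := by
      by_contra hnot
      exact hyC (hC.le_of_ge hnot le_sup_left (Submodule.mem_sup_right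
        (Submodule.mem_span_singleton_self y)))
    obtain ⟨c, hc, w, hw, hcw⟩ := Submodule.mem_sup.1 hmem
    obtain ⟨a, rfl⟩ := Submodule.mem_span_singleton.1 hw
    refine ⟨a, ?_⟩
    rw [← hcw, map_add, map_smul, Submodule.mkQ_apply C c, (Submodule.Quotient.mk_eq_zero C).2 hc,
      zero_add]
  have hσC0 : C.mkQ σ ≠ 0 := fun h0 => hCσ ((Submodule.Quotient.mk_eq_zero C).1 h0)
  have hmem : ∀ k (z : V), e k • z = z → z ∈ Submodule.span A {v} ⊔ C := by
    intro k z hz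
    have hlift : (∃ a : A, C.mkQ z = a • C.mkQ v) → z ∈ Submodule.span A {v} ⊔ C := by
      rintro ⟨a, ha⟩
      have h1 : z - a • v ∈ C := by
        rw [← Submodule.Quotient.mk_eq_zero, ← Submodule.mkQ_apply, map_sub, ha, map_smul, sub_self]
      rw [← add_sub_cancel (a • v) z]
      exact Submodule.add_mem_sup (Submodule.smul_mem _ a (Submodule.mem_span_singleton_self v)) h1
    have hvC : e i • C.mkQ v = C.mkQ v := by rw [← map_smul, hv]
    have hzC : e k • C.mkQ z = C.mkQ z := by rw [← map_smul, hz]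
    rcases h.exists_smul_eq_or hx (σ := C.mkQ σ) (by rw [← map_smul, hσ]) hσC0 hess _ le_rfl
      hzC hvC (m := n + 1) (m' := n + 1)
      (by rw [← map_smul, hmax k z hz, map_zero]) (by rw [← map_smul, hmax i v hv, map_zero])
      with ha | ⟨a, ha⟩
    · exact hlift ha
    · have ha' : C.mkQ v = (e i * a * e k) • C.mkQ z := by
        rw [mul_smul, hzC, mul_smul, ← ha, hvC]
      have ha0 : e i * a * e k ≠ 0 := fun h0 => hσC0 <| by
        rw [hσdef, map_smul, ha', h0, zero_smul, smul_zero]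
      obtain ⟨t, c, hc, ⟨d, hd⟩, hac⟩ := h.exists_eq_mul_path hx (h.peirce_mk i k a) ha0
      rcases Nat.eq_zero_or_pos t with rfl | ht
      · refine hlift ⟨d, ?_⟩
        rw [ha', hac, arrowPath, ← mul_smul, ← mul_assoc, hd, Function.iterate_zero_apply, h.idem,
          hzC]
      -- A proper path taking `z` to `v` modulo `C` would make `z` longer than the maximal length.
      · exfalso
        obtain ⟨c', -, hc'⟩ := h.path_comm hx hc n
        obtain ⟨r, rfl⟩ := Nat.exists_eq_add_of_le' ht
        refine hσC0 ?_
        rw [hσdef, map_smul, ha', hac, ← mul_smul, ← mul_assoc, hc', mul_assoc, h.path_add hx,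
          show n + (r + Nat.succ 0) = r + (n + 1) by omega, ← h.path_add hx, mul_smul, mul_smul,
          ← map_smul, hmax k z hz, map_zero, smul_zero, smul_zero]
  refine ⟨i, v, C, hv, fun h0 => hσ0 (by rw [hσdef, h0, smul_zero]), ?_, ?_⟩
  -- Every nonzero submodule of `A v` contains `σ`, which is not in `C`.
  · rw [Submodule.disjoint_def]
    intro u hu huC
    obtain ⟨a, rfl⟩ := Submodule.mem_span_singleton.1 hu
    by_contra hu0
    obtain ⟨k, hk⟩ := h.exists_smul_ne_zero hu0
    have hka : (e k * a * e i) • v = e k • a • v := by rw [mul_smul, hv, mul_smul]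
    obtain ⟨t, c, hc, ⟨d, hd⟩, hac⟩ := h.exists_eq_mul_path hx (h.peirce_mk k i a)
      (fun h0 => hk (by rw [← hka, h0, zero_smul]))
    have h1 : arrowPath e s x i t • v ∈ C := by
      have : arrowPath e s x i t • v = d • e k • a • v := by
        rw [← hka, hac, ← mul_smul, ← mul_assoc, hd, (h.path_peirce hx i t).1]
      rw [this]
      exact C.smul_mem _ (C.smul_mem _ huC)
    by_cases htn : t ≤ n
    · obtain ⟨r, rfl⟩ := Nat.exists_eq_add_of_le' htn
      refine hCσ ?_
      rw [hσdef, ← h.path_add hx, mul_smul]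
      exact C.smul_mem _ h1
    · obtain ⟨r, rfl⟩ := Nat.exists_eq_add_of_le' (show n + 1 ≤ t by omega)
      refine hk ?_
      rw [← hka, hac, ← h.path_add hx, mul_smul, mul_smul, hmax i v hv, smul_zero, smul_zero]
  · rw [codisjoint_iff_le_sup]
    intro z _
    rw [← h.sum_smul z]
    exact Submodule.sum_mem _ fun k _ => hmem k _ (by rw [← mul_smul, h.idem])

end IsSerialFamily

section Indecomposable

variable {A : Type u} [Ring A]

/-- A direct sum decomposition of an indecomposable module is trivial. -/
lemma CategoryTheory.Indecomposable.subsingleton_or {M : ModuleCat.{u} A}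
    (hM : Indecomposable M) {Y Z : Type u} [AddCommGroup Y] [Module A Y] [AddCommGroup Z]
    [Module A Z] (f : M ≃ₗ[A] Y × Z) : Subsingleton Y ∨ Subsingleton Z := by
  have := hM.2 (ModuleCat.of A Y) (ModuleCat.of A Z)
    ((f.toModuleIso : M ≅ ModuleCat.of A (Y × Z)) ≪≫ (ModuleCat.biprodIsoProd (ModuleCat.of A Y) (ModuleCat.of A Z)).symm)
  simpa only [ModuleCat.isZero_iff_subsingleton] using this

/-- Indecomposable modules over a serial algebra are cyclic, with uniserial structure. -/
lemma IsSerialFamily.exists_hasTop {ι : Type*} [IsArtinianRing A] [Fintype ι] {e : ι → A}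
    (h : IsSerialFamily e) {s : ι → ι} {x : ι → A} (hx : ∀ i, IsArrow e i (s i) (x i))
    {M : ModuleCat.{u} A} (hM : Indecomposable M) :
    ∃ (i : ι) (m : ℕ) (v : M), HasTop e s x i m v := by
  have : Nontrivial M := by
    rw [← not_subsingleton_iff_nontrivial, ← ModuleCat.isZero_iff_subsingleton]
    exact hM.1
  obtain ⟨i, v, C, hv, hv0, hC⟩ := h.exists_isCompl_span hx (V := M)
  rcases hM.subsingleton_or (Submodule.prodEquivOfIsCompl _ _ hC).symm with hs | hs
  · have h1 : Submodule.span A {v} = ⊥ := Submodule.subsingleton_iff_eq_bot.1 hs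
    exact absurd (Submodule.span_singleton_eq_bot.1 h1) hv0
  · have h1 : C = ⊥ := Submodule.subsingleton_iff_eq_bot.1 hs
    have h2 := hC.sup_eq_top
    rw [h1, sup_bot_eq] at h2
    obtain ⟨m, hm⟩ := HasTop.exists_length h hx hv fun y => by
      obtain ⟨a, ha⟩ := Submodule.mem_span_singleton.1 (h2 ▸ Submodule.mem_top (x := y))
      exact ⟨a, ha.symm⟩
    exact ⟨i, m, v, hm⟩

end Indecomposable

/-! ### From Nakayama algebras to serial families -/

section Primitive

/-- An idempotent which is not a sum of two nonzero orthogonal idempotents. -/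
structure IsPrimitiveIdem {A : Type*} [Ring A] (e : A) : Prop where
  idem : e * e = e
  ne_zero : e ≠ 0
  eq_zero_or : ∀ g : A, g * g = g → e * g = g → g * e = g → g = 0 ∨ g = e

/-- Any submodule can be refined to a composition series, which must be the unique one; hence all
submodules lie on one chain. -/
lemma IsUniserial.le_total {A M : Type*} [Ring A] [AddCommGroup M] [Module A M] [IsNoetherian A M]
    [IsArtinian A M] (h : IsUniserial A M) (U W : Submodule A M) : U ≤ W ∨ W ≤ U := by
  obtain ⟨s, -, hs⟩ := h
  have key : ∀ U : Submodule A M, U ∈ s := fun U => by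
    obtain ⟨t, i, hti, ht⟩ :=
      LTSeries.exists_relSeries_covBy_and_head_eq_bot_and_last_eq_bot (RelSeries.singleton _ U)
    have hts : (t : CompositionSeries (Submodule A M)) = s := hs t ht
    rw [← hts]
    exact ⟨i 0, congr_fun hti 0⟩
  exact CompositionSeries.total (key U) (key W)

variable {A : Type u} [Ring A]

lemma projective_span_of_idem {e : A} (he : e * e = e) :
    Module.Projective A (Submodule.span A {e}) := by
  refine Module.Projective.of_split (M := A) (Submodule.subtype _)
    (LinearMap.toSpanSingleton A _ ⟨e, Submodule.mem_span_singleton_self e⟩) ?_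
  ext ⟨a, ha⟩
  obtain ⟨c, rfl⟩ := Submodule.mem_span_singleton.1 ha
  simp [mul_assoc, he]

/-- The projection onto a summand is right multiplication by the image of `e`, an idempotent below
`e`, hence `0` or `e`. -/
lemma IsPrimitiveIdem.indecomposable {e : A} (he : IsPrimitiveIdem e) :
    Indecomposable (ModuleCat.of A (Submodule.span A {e})) := by
  have hgen : ∀ y : Submodule.span A {e},
      y = (y : A) • (⟨e, Submodule.mem_span_singleton_self e⟩ : Submodule.span A {e}) := by
    rintro ⟨y, hy⟩
    obtain ⟨c, rfl⟩ := Submodule.mem_span_singleton.1 hy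
    ext
    simp [mul_assoc, he.idem]
  constructor
  · rw [ModuleCat.isZero_iff_subsingleton]
    intro hs
    exact he.ne_zero (congrArg Subtype.val (hs.elim ⟨e, Submodule.mem_span_singleton_self e⟩ 0))
  intro Y Z iso
  rw [ModuleCat.isZero_iff_subsingleton, ModuleCat.isZero_iff_subsingleton]
  let f : Submodule.span A {e} ≃ₗ[A] Y × Z :=
    (iso ≪≫ ModuleCat.biprodIsoProd Y Z).toLinearEquiv
  let q : Submodule.span A {e} →ₗ[A] Submodule.span A {e} :=
    f.symm.toLinearMap ∘ₗ LinearMap.inl A Y Z ∘ₗ LinearMap.fst A Y Z ∘ₗ f.toLinearMap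
  have hq : ∀ y, q y = f.symm ((f y).1, 0) := fun y => rfl
  have hqq : ∀ y, q (q y) = q y := fun y => by simp [hq]
  set E : Submodule.span A {e} := ⟨e, Submodule.mem_span_singleton_self e⟩
  have hqE : ∀ y : Submodule.span A {e}, q y = (y : A) • q E := fun y => by
    conv_lhs => rw [hgen y]
    rw [map_smul]
  have hval : ∀ y : Submodule.span A {e}, (q y : A) = y * (q E : A) := fun y => by
    conv_lhs => rw [hqE]
    rfl
  rcases he.eq_zero_or (q E : A) ((hval (q E)).symm.trans (by rw [hqq])) (hval E).symm
    (congrArg Subtype.val (hgen (q E))).symm with h0 | h1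
  · left
    refine ⟨fun y y' => ?_⟩
    have hz : ∀ y : Y, y = 0 := fun y => by
      have h2 : q (f.symm (y, 0)) = 0 := Subtype.ext (by rw [hval, h0, mul_zero]; rfl)
      rw [hq, f.apply_symm_apply, LinearEquiv.map_eq_zero_iff] at h2
      exact congrArg Prod.fst h2
    rw [hz y, hz y']
  · right
    refine ⟨fun y y' => ?_⟩
    have hz : ∀ z : Z, z = 0 := fun z => by
      have h2 : q (f.symm (0, z)) = f.symm (0, z) := Subtype.ext (by
        rw [hval, h1]
        exact (congrArg Subtype.val (hgen (f.symm (0, z)))).symm)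
      rw [hq, f.apply_symm_apply] at h2
      exact (congrArg Prod.snd (f.symm.injective h2)).symm
    rw [hz y, hz y']

lemma IsPrimitiveIdem.left_total [IsArtinianRing A] [IsNoetherianRing A]
    (hA : ∀ P : ModuleCat.{u} A, Module.Projective A P → Indecomposable P → IsUniserial A P)
    {e : A} (he : IsPrimitiveIdem e) {a b : A} (ha : a * e = a) (hb : b * e = b) :
    (∃ c, a = c * b) ∨ ∃ c, b = c * a := by
  have hu : IsUniserial A (Submodule.span A {e}) :=
    hA (ModuleCat.of A (Submodule.span A {e})) (projective_span_of_idem he.idem) he.indecomposable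
  have key : ∀ {a b : A} (ha : a * e = a) (hb : b * e = b),
      (Submodule.span A {(⟨a, Submodule.mem_span_singleton.2 ⟨a, ha⟩⟩ : Submodule.span A {e})} ≤
      Submodule.span A {⟨b, Submodule.mem_span_singleton.2 ⟨b, hb⟩⟩}) → ∃ c, a = c * b := by
    intro a b ha hb hle
    obtain ⟨c, hc⟩ := Submodule.mem_span_singleton.1
      (hle (Submodule.mem_span_singleton_self _))
    exact ⟨c, (congrArg Subtype.val hc).symm⟩
  exact (hu.le_total _ _).imp (key ha hb) (key hb ha)

/-- Every idempotent of an Artinian ring is a sum of orthogonal primitive idempotents. -/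
lemma exists_primitive_decomposition [IsArtinianRing A] (e : A) (he : e * e = e) :
    ∃ S : Finset A, (∀ f ∈ S, IsPrimitiveIdem f ∧ f * e = f ∧ e * f = f) ∧
      (∀ f ∈ S, ∀ g ∈ S, f ≠ g → f * g = 0) ∧ ∑ f ∈ S, f = e := by
  classical
  induction hI : Submodule.span A {e} using WellFoundedLT.induction generalizing e with
  | _ I ih =>
  subst hI
  by_cases h0 : e = 0
  · exact ⟨∅, by simp, by simp, by simp [h0]⟩
  by_cases hp : IsPrimitiveIdem e
  · exact ⟨{e}, by simp [hp, he], by simp, by simp⟩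
  have : ∃ g : A, g * g = g ∧ e * g = g ∧ g * e = g ∧ g ≠ 0 ∧ g ≠ e := by
    by_contra! hc
    exact hp ⟨he, h0, fun g h1 h2 h3 => or_iff_not_imp_left.2 (hc g h1 h2 h3)⟩
  obtain ⟨g, hgg, heg, hge, hg0, hgne⟩ := this
  have hlt : ∀ g : A, e * g = g → g * e = g → g * g = g → g ≠ e →
      Submodule.span A {g} < Submodule.span A {e} := fun g heg hge hgg hgne => by
    refine lt_of_le_of_ne ?_ fun heq => hgne ?_
    · rw [Submodule.span_singleton_le_iff_mem]
      exact Submodule.mem_span_singleton.2 ⟨g, hge⟩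
    · obtain ⟨c, hc⟩ := Submodule.mem_span_singleton.1
        (heq ▸ Submodule.mem_span_singleton_self e : e ∈ Submodule.span A {g})
      rw [smul_eq_mul] at hc
      rw [← heg, ← hc, mul_assoc, hgg]
  have hgg' : (e - g) * (e - g) = e - g := by
    rw [mul_sub, sub_mul, sub_mul, he, hge, heg, hgg, sub_self, sub_zero]
  have heg' : e * (e - g) = e - g := by rw [mul_sub, he, heg]
  have hge' : (e - g) * e = e - g := by rw [sub_mul, he, hge]
  have hgo : g * (e - g) = 0 := by rw [mul_sub, hge, hgg, sub_self]
  have hgo' : (e - g) * g = 0 := by rw [sub_mul, heg, hgg, sub_self]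
  obtain ⟨S, hS1, hS2, hS3⟩ := ih _ (hlt g heg hge hgg hgne) g hgg rfl
  obtain ⟨T, hT1, hT2, hT3⟩ := ih _ (hlt (e - g) heg' hge' hgg' (by simpa using hg0))
    (e - g) hgg' rfl
  have hST : ∀ f ∈ S, ∀ f' ∈ T, f * f' = 0 := fun f hf f' hf' => by
    rw [← (hS1 f hf).2.1, ← (hT1 f' hf').2.2, mul_assoc, ← mul_assoc g, hgo, zero_mul, mul_zero]
  have hTS : ∀ f ∈ S, ∀ f' ∈ T, f' * f = 0 := fun f hf f' hf' => by
    rw [← (hS1 f hf).2.2, ← (hT1 f' hf').2.1, mul_assoc, ← mul_assoc (e - g), hgo', zero_mul,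
      mul_zero]
  refine ⟨S ∪ T, fun f hf => ?_, fun f hf f' hf' hne => ?_, ?_⟩
  · rcases Finset.mem_union.1 hf with hf | hf
    · obtain ⟨h1, h2, h3⟩ := hS1 f hf
      exact ⟨h1, by rw [← h2, mul_assoc, hge], by rw [← h3, ← mul_assoc, heg]⟩
    · obtain ⟨h1, h2, h3⟩ := hT1 f hf
      exact ⟨h1, by rw [← h2, mul_assoc, hge'], by rw [← h3, ← mul_assoc, heg']⟩
  · rcases Finset.mem_union.1 hf with hf | hf <;> rcases Finset.mem_union.1 hf' with hf' | hf'
    · exact hS2 f hf f' hf' hne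
    · exact hST f hf f' hf'
    · exact hTS f' hf' f hf
    · exact hT2 f hf f' hf' hne
  · rw [Finset.sum_union, hS3, hT3, add_sub_cancel]
    refine Finset.disjoint_left.2 fun f hf hf' => (hS1 f hf).1.ne_zero ?_
    rw [← (hS1 f hf).1.idem, hST f hf f hf']

lemma IsNakayamaAlgebra.exists_isSerialFamily {K : Type*} [Field K] [Algebra K A]
    (hA : IsNakayamaAlgebra K A) :
    ∃ (ι : Type u) (_ : Fintype ι) (e : ι → A), IsSerialFamily e := by
  have := hA.finite
  have : IsArtinianRing A := IsArtinianRing.of_finite K A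
  have : IsNoetherianRing A := IsNoetherianRing.of_finite K A
  have : Module.Finite K Aᵐᵒᵖ := Module.Finite.equiv (MulOpposite.opLinearEquiv K)
  have : IsArtinianRing Aᵐᵒᵖ := IsArtinianRing.of_finite K Aᵐᵒᵖ
  have : IsNoetherianRing Aᵐᵒᵖ := IsNoetherianRing.of_finite K Aᵐᵒᵖ
  obtain ⟨S, hS1, hS2, hS3⟩ := exists_primitive_decomposition (1 : A) (one_mul 1)
  refine ⟨S, inferInstance, Subtype.val, ⟨⟨fun f => (hS1 f f.2).1.idem, fun f g hfg =>
    hS2 f f.2 g g.2 fun hc => hfg (Subtype.ext hc)⟩, ?_⟩, fun f => (hS1 f f.2).1.ne_zero,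
    fun f a b ha hb => (hS1 f f.2).1.left_total hA.left_uniserial ha hb, fun f a b ha hb => ?_⟩
  · rw [← hS3]
    exact Finset.sum_coe_sort S id
  · have hf := (hS1 f f.2).1
    have hop : IsPrimitiveIdem (MulOpposite.op (f : A)) :=
      ⟨by rw [← MulOpposite.op_mul, hf.idem], by simpa using hf.ne_zero, fun g h1 h2 h3 => by
        rcases hf.eq_zero_or g.unop (congrArg MulOpposite.unop h1) (congrArg MulOpposite.unop h3)
          (congrArg MulOpposite.unop h2) with h4 | h4
        · exact .inl (MulOpposite.unop_injective h4)
        · exact .inr (MulOpposite.unop_injective h4)⟩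
    rcases hop.left_total hA.right_uniserial (a := MulOpposite.op a) (b := MulOpposite.op b)
      (by rw [← MulOpposite.op_mul, ha]) (by rw [← MulOpposite.op_mul, hb]) with ⟨c, hc⟩ | ⟨c, hc⟩
    · exact .inl ⟨c.unop, congrArg MulOpposite.unop hc⟩
    · exact .inr ⟨c.unop, congrArg MulOpposite.unop hc⟩

end Primitive

/-! ### Uniqueness of syzygies -/

section ProjectiveCover

variable {A : Type u} [Ring A]

/-- The kernels of two projective covers of a module are isomorphic. -/
lemma IsProjectiveCover.nonempty_ker_iso {P Q M : ModuleCat.{u} A} {p : P ⟶ M} {q : Q ⟶ M}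
    (hp : IsProjectiveCover p) (hq : IsProjectiveCover q) :
    Nonempty (ModuleCat.of A (LinearMap.ker p.hom) ≅ ModuleCat.of A (LinearMap.ker q.hom)) := by
  have := hp.projective
  have := hq.projective
  obtain ⟨g, hg⟩ := Module.projective_lifting_property q.hom p.hom hq.surjective
  have hgp : ∀ y, q.hom (g y) = p.hom y := fun y => LinearMap.congr_fun hg y
  -- Superfluity of the kernel of `q` makes the lift onto; superfluity of the kernel of `p` then
  -- makes its section onto as well, so `g` is bijective.
  have hsurj : Function.Surjective g := by
    rw [← LinearMap.range_eq_top]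
    refine hq.superfluous _ (eq_top_iff.2 fun y _ => ?_)
    obtain ⟨w, hw⟩ := hp.surjective (q.hom y)
    rw [← add_sub_cancel (g w) y]
    refine Submodule.add_mem_sup ⟨w, rfl⟩ ?_
    rw [LinearMap.mem_ker, map_sub, hgp, hw, sub_self]
  obtain ⟨f, hf⟩ := Module.projective_lifting_property g LinearMap.id hsurj
  have hgf : ∀ y, g (f y) = y := fun y => LinearMap.congr_fun hf y
  have hfs : Function.Surjective f := by
    rw [← LinearMap.range_eq_top]
    refine hp.superfluous _ (eq_top_iff.2 fun y _ => ?_)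
    rw [← add_sub_cancel (f (g y)) y]
    refine Submodule.add_mem_sup ⟨g y, rfl⟩ ?_
    rw [LinearMap.mem_ker, map_sub, ← hgp (f (g y)), hgf, hgp, sub_self]
  have hinj : Function.Injective g := by
    intro y y' hyy'
    obtain ⟨w, rfl⟩ := hfs y
    obtain ⟨w', rfl⟩ := hfs y'
    rw [hgf, hgf] at hyy'
    rw [hyy']
  let G : P ≃ₗ[A] Q := LinearEquiv.ofBijective g ⟨hinj, hsurj⟩
  refine ⟨(LinearEquiv.ofSubmodules G _ (LinearMap.ker q.hom) ?_).toModuleIso⟩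
  ext y
  constructor
  · rintro ⟨w, hw, rfl⟩
    exact (hgp w).trans hw
  · intro hy
    refine ⟨G.symm y, ?_, G.apply_symm_apply y⟩
    refine (hgp (G.symm y)).symm.trans ?_
    exact (congrArg q.hom (G.apply_symm_apply y)).trans hy

lemma IsFirstSyzygy.nonempty_iso {X M P : ModuleCat.{u} A} (hX : IsFirstSyzygy X M) {p : P ⟶ M}
    (hp : IsProjectiveCover p) : Nonempty (X ≅ ModuleCat.of A (LinearMap.ker p.hom)) := by
  obtain ⟨Q, q, hq, ⟨f⟩⟩ := hX
  obtain ⟨g⟩ := hq.nonempty_ker_iso hp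
  exact ⟨f ≪≫ g⟩

end ProjectiveCover

/-! ### Ext¹ as a cokernel -/

section Ext

variable {K : Type*} [Field K] {A : Type u} [Ring A] [Algebra K A]

open Abelian

/-- The connecting homomorphism of the contravariant long exact sequence. -/
noncomputable def extConnecting (K : Type*) [Field K] [Algebra K A]
    {S : ShortComplex (ModuleCat.{u} A)} (hS : S.ShortExact) (N : ModuleCat.{u} A) :
    (S.X₁ ⟶ N) →ₗ[K] Ext.{u} S.X₃ N 1 :=
  (Ext.precompOfLinear hS.extClass K N (add_zero 1)) ∘ₗ
    (Ext.linearEquiv₀ (R := K)).symm.toLinearMap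

lemma extConnecting_surjective {S : ShortComplex (ModuleCat.{u} A)} (hS : S.ShortExact)
    [Projective S.X₂] (N : ModuleCat.{u} A) : Function.Surjective (extConnecting K hS N) := by
  intro y
  obtain ⟨z, hz⟩ := Ext.contravariant_sequence_exact₃ hS N y (Ext.eq_zero_of_projective _)
    (add_zero 1)
  refine ⟨Ext.linearEquiv₀ (R := K) z, ?_⟩
  rw [extConnecting, LinearMap.comp_apply, LinearEquiv.coe_coe, LinearEquiv.symm_apply_apply]
  exact hz

lemma ker_extConnecting_le {S : ShortComplex (ModuleCat.{u} A)} (hS : S.ShortExact)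
    (N : ModuleCat.{u} A) :
    LinearMap.ker (extConnecting K hS N) ≤ LinearMap.range (Linear.leftComp K N S.f) := by
  intro f hf
  obtain ⟨z, hz⟩ := Ext.contravariant_sequence_exact₁ hS N (Ext.mk₀ f) (add_zero 1) hf
  refine ⟨Ext.linearEquiv₀ (R := K) z, ?_⟩
  rw [← Ext.mk₀_linearEquiv₀_apply (R := K) z, Ext.mk₀_comp_mk₀] at hz
  exact Ext.mk₀_bijective _ _ |>.injective hz

lemma rank_ext_le {S : ShortComplex (ModuleCat.{u} A)} (hS : S.ShortExact) [Projective S.X₂]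
    (N : ModuleCat.{u} A) :
    Module.rank K (Ext.{u} S.X₃ N 1) ≤ Module.rank K (S.X₁ ⟶ N) :=
  LinearMap.rank_le_of_surjective _ (extConnecting_surjective hS N)

/-- Rank–nullity for the connecting map, stated additively since cardinals do not subtract well.
Only an upper bound on its kernel is needed. -/
lemma rank_hom_le_rank_ext_add {S : ShortComplex (ModuleCat.{u} A)} (hS : S.ShortExact)
    [Projective S.X₂] (N : ModuleCat.{u} A) :
    Module.rank K (S.X₁ ⟶ N) ≤ Module.rank K (Ext.{u} S.X₃ N 1) +
      Module.rank K (LinearMap.range (Linear.leftComp K N S.f)) := by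
  rw [← LinearMap.rank_range_add_rank_ker (extConnecting K hS N),
    LinearMap.range_eq_top.2 (extConnecting_surjective hS N), rank_top]
  gcongr
  exact Submodule.rank_mono (ker_extConnecting_le hS N)

end Ext

/-! ### Homomorphism spaces -/

section Hom

open ModuleCat

variable {K : Type*} [Field K] {A : Type u} [Ring A] [Algebra K A]

/-- Evaluation of homomorphisms at an element, as a linear map. -/
def homEval (K : Type*) [Field K] [Algebra K A] {X : ModuleCat.{u} A} (N : ModuleCat.{u} A)
    (z : X) : (X ⟶ N) →ₗ[K] N where
  toFun f := f.hom z
  map_add' _ _ := rfl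
  map_smul' _ _ := rfl

variable {ι : Type*} {e : ι → A} {s : ι → ι} {x : ι → A}

lemma HasTop.homEval_injective {X : ModuleCat.{u} A} {b : ι} {l : ℕ} {z : X}
    (hz : HasTop e s x b l z) (N : ModuleCat.{u} A) : Function.Injective (homEval K N z) :=
  fun _ _ hfg => ModuleCat.hom_ext (hz.map_ext hfg)

variable [FiniteDimensional K A] [IsArtinianRing A] [Fintype ι] (h : IsSerialFamily e)
  (hx : ∀ i, IsArrow e i (s i) (x i))

include h hx

omit [FiniteDimensional K A] in
-- A map out of `X` is a choice of image for the generator: any element of `e b • N` killed by the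
-- path of length `l`, and by `mem_layer_sub_iff` these form a radical layer.
lemma HasTop.range_homEval {X N : ModuleCat.{u} A} {b k : ι} {l m : ℕ} {z : X} {v : N}
    (hz : HasTop e s x b l z) (hv : HasTop e s x k m v) :
    LinearMap.range (homEval K N z) = layer K e b (arrowPath e s x k (m - l) • v) := by
  ext y
  rw [hv.mem_layer_sub_iff h hx]
  constructor
  · rintro ⟨f, rfl⟩
    change e b • f.hom z = f.hom z ∧ _ • f.hom z = 0
    rw [← map_smul, ← map_smul, hz.idem_smul, hz.path_smul_eq_zero, map_zero]
    exact ⟨rfl, rfl⟩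
  · rintro ⟨h1, h2⟩
    obtain ⟨f, hf⟩ := hz.exists_map h hx h1 h2
    exact ⟨ModuleCat.ofHom f, hf⟩

lemma HasTop.rank_hom {X N : ModuleCat.{u} A} {b k : ι} {l m : ℕ} {z : X} {v : N}
    (hz : HasTop e s x b l z) (hv : HasTop e s x k m v) :
    Module.rank K (X ⟶ N) =
      Module.finrank K (layer K e b (arrowPath e s x k (m - l) • v)) := by
  have := hv.finiteDimensional K
  rw [Module.finrank_eq_rank, ← hz.range_homEval h hx hv]
  exact (LinearEquiv.ofInjective _ (hz.homEval_injective N)).rank_eq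

end Hom

/-! ### Projective covers and syzygies of uniserial modules -/

section Cover

variable {A : Type u} [Ring A] {ι : Type*} {e : ι → A} {s : ι → ι} {x : ι → A}

/-- The map `A * e i → M`, `a ↦ a • v`. -/
def coverMap (e : ι → A) (i : ι) {M : Type*} [AddCommGroup M] [Module A M] (v : M) :
    Submodule.span A {e i} →ₗ[A] M :=
  LinearMap.toSpanSingleton A M v ∘ₗ Submodule.subtype _

/-- The path of length `m` as an element of the kernel of `coverMap`. -/
def coverKerGenerator {i : ι} {m : ℕ} {M : Type*} [AddCommGroup M] [Module A M] {v : M}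
    (hp : Peirce e (s^[m] i) i (arrowPath e s x i m))
    (hv : HasTop e s x i m v) : LinearMap.ker (coverMap e i v) :=
  ⟨⟨arrowPath e s x i m, Submodule.mem_span_singleton.2 ⟨_, hp.2⟩⟩, hv.path_smul_eq_zero⟩

variable [IsArtinianRing A] [Fintype ι] (h : IsSerialFamily e)
  (hx : ∀ i, IsArrow e i (s i) (x i)) {M : Type*} [AddCommGroup M] [Module A M]
  {i : ι} {m : ℕ} {v : M}

include h

omit [IsArtinianRing A] [Fintype ι] h in
lemma HasTop.coverMap_surjective (hv : HasTop e s x i m v) :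
    Function.Surjective (coverMap e i v) := by
  intro y
  obtain ⟨a, rfl⟩ := hv.generates y
  refine ⟨⟨a * e i, Submodule.mem_span_singleton.2 ⟨a, rfl⟩⟩, ?_⟩
  change (a * e i) • v = a • v
  rw [mul_smul, hv.idem_smul]

omit [IsArtinianRing A] in
lemma mul_eq_of_mem_span {a : A} (ha : a ∈ Submodule.span A {e i}) : a * e i = a := by
  obtain ⟨c, rfl⟩ := Submodule.mem_span_singleton.1 ha
  rw [smul_eq_mul, mul_assoc, h.idem]

include hx

/-- The annihilator of `v` in `A * e i` is generated by the path of length `m`, and `L - m` further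
arrows kill that path. -/
lemma HasTop.kerGenerator {L : ℕ} (hv : HasTop e s x i m v) (hL : arrowPath e s x i L = 0)
    (hlt : ∀ t < L, arrowPath e s x i t ≠ 0) :
    HasTop e s x (s^[m] i) (L - m) (coverKerGenerator (h.path_peirce hx i m) hv) := by
  have hmL : m ≤ L := (hv.path_smul_eq_zero_iff h hx).1 (by rw [hL, zero_smul])
  refine ⟨?_, ?_, ?_, ?_⟩
  · exact Subtype.ext (Subtype.ext (h.path_peirce hx i m).1)
  · rintro ⟨⟨y, hy⟩, hyv⟩
    obtain ⟨c, hc⟩ := (hv.smul_eq_zero_iff h hx (mul_eq_of_mem_span h hy)).1 hyv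
    exact ⟨c, Subtype.ext (Subtype.ext hc)⟩
  · refine Subtype.ext (Subtype.ext ?_)
    change arrowPath e s x (s^[m] i) (L - m) * arrowPath e s x i m = 0
    rw [h.path_add hx, Nat.sub_add_cancel hmL, hL]
  · intro t ht h0
    refine hlt (t + m) (by omega) ?_
    rw [← h.path_add hx]
    exact congrArg (fun z => ((z : Submodule.span A {e i}) : A)) (congrArg Subtype.val h0)

omit hx [IsArtinianRing A] in
-- Write `e i = a + b` with `a` in `U` and `b` in the kernel. As `b` kills `v ≠ 0` it is a
-- non-generator, so `a` generates.
lemma HasTop.isProjectiveCover {M : ModuleCat.{u} A} {v : M}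
    (hv : HasTop e s x i m v) (hv0 : v ≠ 0) :
    IsProjectiveCover (ModuleCat.ofHom (coverMap e i v)) := by
  refine ⟨projective_span_of_idem (h.idem i), hv.coverMap_surjective, fun U hU => ?_⟩
  rw [ModuleCat.hom_ofHom] at hU
  have hE : (⟨e i, Submodule.mem_span_singleton_self _⟩ : Submodule.span A {e i}) ∈
      U ⊔ LinearMap.ker (coverMap e i v) := hU ▸ Submodule.mem_top
  obtain ⟨⟨a, ha⟩, haU, ⟨b, hb⟩, hbv, hab⟩ := Submodule.mem_sup.1 hE
  have hab' : a + b = e i := congrArg Subtype.val hab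
  have hgen : ∃ c, c * a = e i := by
    rcases h.gen_of_add (mul_eq_of_mem_span h ha) (mul_eq_of_mem_span h hb)
      ⟨e i, by rw [hab', h.idem]⟩ with hg | ⟨c, hc⟩
    · exact hg
    · refine absurd ?_ hv0
      have hbv' : b • v = 0 := hbv
      rw [← hv.idem_smul, ← hc, mul_smul, hbv', smul_zero]
  obtain ⟨c, hc⟩ := hgen
  rw [eq_top_iff]
  rintro ⟨y, hy⟩ -
  have hy' : (⟨y, hy⟩ : Submodule.span A {e i}) = (y * c) • ⟨a, ha⟩ := by
    refine Subtype.ext ?_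
    change y = y * c * a
    rw [mul_assoc, hc, mul_eq_of_mem_span h hy]
  rw [hy']
  exact U.smul_mem _ haU

end Cover

/-! ### The estimate for Ext¹ -/

namespace HasTop

open ModuleCat Abelian

variable {K : Type*} [Field K] {A : Type u} [Ring A] [Algebra K A] {ι : Type*} {e : ι → A}
  {s : ι → ι} {x : ι → A} [FiniteDimensional K A] [IsArtinianRing A] [Fintype ι]
  (h : IsSerialFamily e) (hx : ∀ i, IsArrow e i (s i) (x i))

include h

omit [IsArtinianRing A] [FiniteDimensional K A] in
lemma shortExact_coverMap {M : ModuleCat.{u} A} {i : ι} {m : ℕ} {v : M}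
    (hv : HasTop e s x i m v) :
    (coverMap e i v).shortComplexKer.ShortExact ∧
      Projective (coverMap e i v).shortComplexKer.X₂ := by
  refine ⟨LinearMap.shortExact_shortComplexKer hv.coverMap_surjective, ?_⟩
  exact (IsProjective.iff_projective _).1 (projective_span_of_idem (h.idem i))

include hx

/-- The dimension of the space of maps from the syzygy to `N` which extend to the cover. -/
lemma rank_range_le {M N : ModuleCat.{u} A} {i k : ι} {m m' j : ℕ} {v : M} {v' : N}
    (hv : HasTop e s x i m v) (hv' : HasTop e s x k m' v')
    (hj : ∀ t, IdemRel e (s^[t] k) i → j ≤ t) :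
    Module.rank K (LinearMap.range (Linear.leftComp K N (coverMap e i v).shortComplexKer.f)) ≤
      Module.finrank K (layer K e (s^[m] i) (arrowPath e s x k (m + j) • v')) := by
  classical
  have := hv'.finiteDimensional K
  have hL := Nat.find_spec (h.exists_path_eq_zero hx i)
  have hω := hv.kerGenerator h hx hL fun t ht => Nat.find_min (h.exists_path_eq_zero hx i) ht
  have hinj := HasTop.homEval_injective (X := ModuleCat.of A (LinearMap.ker (coverMap e i v)))
    (K := K) hω N
  rw [Module.finrank_eq_rank, (Submodule.equivMapOfInjective _ hinj _).rank_eq]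
  refine Submodule.rank_mono ?_
  rintro _ ⟨_, ⟨f, rfl⟩, rfl⟩
  -- A map extending to the cover sends the generator of the syzygy to the path of length `m`
  -- applied to an element of `e i • N`.
  let E : Submodule.span A {e i} := ⟨e i, Submodule.mem_span_singleton_self _⟩
  have hE : e i • f.hom E = f.hom E := by
    rw [← map_smul]
    exact congrArg f.hom (Subtype.ext (h.idem i))
  have h1 : homEval K N
      (X := ModuleCat.of A (LinearMap.ker (coverMap e i v)))
      (coverKerGenerator (h.path_peirce hx i m) hv) (Linear.leftComp K N (coverMap e i v).shortComplexKer.f f) =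
      arrowPath e s x i m • f.hom E := by
    rw [← map_smul]
    exact congrArg f.hom (Subtype.ext (h.path_peirce hx i m).2.symm)
  exact h1.symm ▸ hv'.path_smul_mem_layer h hx hj hE

end HasTop

namespace IsSerialFamily

open ModuleCat Abelian

variable {K : Type*} [Field K] {A : Type u} [Ring A] [Algebra K A] {ι : Type*} {e : ι → A}
  {s : ι → ι} {x : ι → A} [FiniteDimensional K A] [IsArtinianRing A] [Fintype ι]
  (h : IsSerialFamily e) (hx : ∀ i, IsArrow e i (s i) (x i))

section Position

omit [Fintype ι] [IsArtinianRing A] [Ring A] in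
lemma _root_.position_iterate {n : ℕ} {pos : ι → ℕ}
    (hpos : ∀ i, pos (s i) ≡ pos i + 1 [MOD n]) (i : ι) (t : ℕ) :
    pos (s^[t] i) ≡ pos i + t [MOD n] := by
  induction t with
  | zero => rfl
  | succ t ih =>
    rw [Function.iterate_succ_apply']
    exact (hpos _).trans (ih.add_right 1)

lemma _root_.exists_add_modEq {n : ℕ} (hn : 0 < n) (a b : ℕ) : ∃ t, a + t ≡ b [MOD n] := by
  obtain ⟨n, rfl⟩ := Nat.exists_eq_succ_of_ne_zero hn.ne'
  refine ⟨b + n * a, ?_⟩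
  rw [show a + (b + n * a) = b + (n + 1) * a by ring]
  simp [Nat.ModEq]

include h hx

lemma topDim_eq_of_position {n : ℕ} (hn : 0 < n) {pos : ι → ℕ}
    (hrel : ∀ i k, IdemRel e i k ↔ pos i ≡ pos k [MOD n])
    (hpos : ∀ i, pos (s i) ≡ pos i + 1 [MOD n]) (hx0 : ∀ i, x i ≠ 0) (i k : ι) :
    topDim K e x k = topDim K e x i := by
  have hiter : ∀ t, topDim K e x (s^[t] i) = topDim K e x i := fun t => by
    induction t with
    | zero => rfl
    | succ t ih => rw [Function.iterate_succ_apply', h.topDim_succ hx (hx0 _), ih]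
  obtain ⟨t, ht⟩ := exists_add_modEq hn (pos i) (pos k)
  rw [← hiter t, ← h.topDim_eq_of_rel hx ((hrel _ _).2 ((position_iterate hpos i t).trans ht))]

end Position

include h hx

open Classical in
/-- The central estimate: self-homomorphisms from syzygies give lower bounds for `Ext`. -/
lemma min_rank_hom_le_rank_ext (hA : IsConnectedRing A) {M N : ModuleCat.{u} A} {i k : ι}
    {m m' : ℕ} {v : M} {v' : N} (hv : HasTop e s x i m v) (hv' : HasTop e s x k m' v') :
    min (Module.rank K (ModuleCat.of A (LinearMap.ker (coverMap e i v)) ⟶ M))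
      (Module.rank K (ModuleCat.of A (LinearMap.ker (coverMap e k v')) ⟶ N)) ≤
      Module.rank K (Ext.{u} M N 1) := by
  have hlen := fun i => h.exists_path_eq_zero hx i
  have hω := hv.kerGenerator h hx (Nat.find_spec (hlen i)) fun t ht => Nat.find_min (hlen i) ht
  have hω' := hv'.kerGenerator h hx (Nat.find_spec (hlen k)) fun t ht => Nat.find_min (hlen k) ht
  have hmL := (hv.path_smul_eq_zero_iff h hx (t := Nat.find (hlen i))).1
    (by rw [Nat.find_spec (hlen i), zero_smul])
  have hmL' := (hv'.path_smul_eq_zero_iff h hx (t := Nat.find (hlen k))).1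
    (by rw [Nat.find_spec (hlen k), zero_smul])
  have hLle : ∀ {t : ℕ}, arrowPath e s x k t = 0 → Nat.find (hlen k) ≤ t :=
    fun ht => Nat.find_min' (hlen k) ht
  have hLspec := Nat.find_spec (hlen i)
  have hLle' : ∀ {t : ℕ}, arrowPath e s x i t = 0 → Nat.find (hlen i) ≤ t :=
    fun ht => Nat.find_min' (hlen i) ht
  generalize Nat.find (hlen i) = L at *
  generalize Nat.find (hlen k) = L' at *
  have hMM := HasTop.rank_hom (K := K) (X := ModuleCat.of A (LinearMap.ker (coverMap e i v)))
    h hx hω hv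
  have hNN := HasTop.rank_hom (K := K) (X := ModuleCat.of A (LinearMap.ker (coverMap e k v')))
    h hx hω' hv'
  have hMN := HasTop.rank_hom (K := K) (X := ModuleCat.of A (LinearMap.ker (coverMap e i v)))
    h hx hω hv'
  have := hv.finiteDimensional K
  have := hv'.finiteDimensional K
  by_cases h0 : layer K e (s^[m] i) (arrowPath e s x i (m - (L - m)) • v) = ⊥
  · rw [hMM, h0, finrank_bot, Nat.cast_zero]
    exact (min_le_left _ _).trans bot_le
  obtain ⟨y, hy, hy0⟩ := Submodule.exists_mem_ne_zero_of_ne_bot h0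
  -- If this path vanished, the syzygy of `M` would have length `0`.
  have hpm : arrowPath e s x i m ≠ 0 := fun hm0 => hy0 <| by
    have := hLle' hm0
    obtain ⟨a, ha⟩ := hy.2
    rw [ha, show m - (L - m) = m by omega, hv.path_smul_eq_zero, smul_zero]
  obtain ⟨n₀, hn₀, i₀, hper, hne⟩ := hv.exists_periodic h hx hpm hy.1 hy0
  obtain ⟨n, hn, pos, hrel, hpos, hx0⟩ := h.exists_position hx hn₀ hper hne hA
  have hd := h.topDim_eq_of_position (K := K) hx hn hrel hpos hx0 i
  set d := topDim K e x i
  have hiter := position_iterate hpos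
  have hrel' : ∀ k i m j, IdemRel e (s^[j] k) (s^[m] i) ↔ pos k + j ≡ pos i + m [MOD n] := by
    intro k i m j
    rw [hrel]
    exact ⟨fun hc => (hiter k j).symm.trans (hc.trans (hiter i m)),
      fun hc => (hiter k j).trans (hc.trans (hiter i m).symm)⟩
  have hself : ∀ i m j, IdemRel e (s^[j] i) (s^[m] i) ↔ j ≡ m [MOD n] := fun i m j => by
    rw [hrel']
    exact ⟨Nat.ModEq.add_left_cancel' _, Nat.ModEq.add_left _⟩
  have hcM := card_filter_modEq_self_mul_le (n := n) (a := m - (L - m)) (b := m)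
  have hcN := card_filter_modEq_self_mul_le (n := n) (a := m' - (L' - m')) (b := m')
  rw [h.finrank_layer_path hx hd hv.path_smul_eq_zero hv.path_smul_ne_zero] at hMM
  rw [h.finrank_layer_path hx hd hv'.path_smul_eq_zero hv'.path_smul_ne_zero] at hNN hMN
  simp only [hself] at hMM hNN
  set cM := ((Finset.Ico (m - (L - m)) m).filter fun j => j ≡ m [MOD n]).card
  set cN := ((Finset.Ico (m' - (L' - m')) m').filter fun j => j ≡ m' [MOD n]).card
  -- the first occurrence of the top of `M` in `N`
  have hex : ∃ t, IdemRel e (s^[t] k) i := by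
    obtain ⟨t, ht⟩ := exists_add_modEq hn (pos k) (pos i)
    exact ⟨t, (hrel' k i 0 t).2 ht⟩
  have hj := Nat.find_spec hex
  have hjmin : ∀ t, IdemRel e (s^[t] k) i → Nat.find hex ≤ t := fun t ht => Nat.find_min' hex ht
  generalize Nat.find hex = j at *
  -- After `j` arrows from `k` the path reaches a copy of `e i`, from which `L` more arrows give
  -- zero.
  have hLL : L' ≤ L + j := hLle <| by
    rw [← h.path_add hx, h.path_eq_zero_of_rel hx hj.symm hLspec, zero_mul]
  have hrange := HasTop.rank_range_le (K := K) h hx hv hv' hjmin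
  rw [h.finrank_layer_path hx hd hv'.path_smul_eq_zero hv'.path_smul_ne_zero] at hrange
  obtain ⟨hS, hproj⟩ := hv.shortExact_coverMap h
  have hext := rank_hom_le_rank_ext_add (K := K) hS N
  replace hext := hext.trans (add_le_add_right hrange _)
  change Module.rank K (ModuleCat.of A (LinearMap.ker (coverMap e i v)) ⟶ N) ≤
    Module.rank K (Ext.{u} M N 1) + _ at hext
  -- Finiteness turns the cardinal inequality into one between natural numbers.
  have hfin : Module.rank K (Ext.{u} M N 1) < Cardinal.aleph0 := by
    refine (rank_ext_le (K := K) hS N).trans_lt ?_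
    change Module.rank K (ModuleCat.of A (LinearMap.ker (coverMap e i v)) ⟶ N) < _
    rw [hMN]
    exact Cardinal.natCast_lt_aleph0
  obtain ⟨q, hq⟩ := Cardinal.lt_aleph0.1 hfin
  rw [hMN, hq] at hext
  rw [hMM, hNN, hq]
  rw [← Nat.mono_cast.map_min, Nat.mul_min_mul_left]
  norm_cast at hext ⊢
  obtain ⟨c, hc⟩ := exists_add_modEq hn (pos k) (pos i + m)
  have hcount : ∀ j, IdemRel e (s^[j] k) (s^[m] i) ↔ j ≡ c [MOD n] := fun j => by
    rw [hrel']
    exact ⟨fun hjc => Nat.ModEq.add_left_cancel' _ (hjc.trans hc.symm),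
      fun hjc => (hjc.add_left _).trans hc⟩
  simp only [hcount] at hext
  set r := min cM cN
  have hrM : r * n ≤ m - (m - (L - m)) := (Nat.mul_le_mul_right n (min_le_left _ _)).trans hcM
  have hrN : r * n ≤ m' - (m' - (L' - m')) :=
    (Nat.mul_le_mul_right n (min_le_right _ _)).trans hcN
  -- The truncated difference needs four estimates: `r * n` is at most `L - m` and `m'` for the
  -- bound by `m'`, and at most `L' - m'` (with `hLL`) and `m` for the bound by `m + j`.
  have hbound : m' - (L - m) + r * n ≤ min m' (m + j) := le_min (by omega) (by omega)
  have h1 := le_card_filter_modEq (c := c) hn hbound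
  -- Removing the positions from `m + j` on, which bound the maps extending to the cover, still
  -- leaves an interval with `r` hits.
  have h2 : ((Finset.Ico (m' - (L - m)) (min m' (m + j))).filter (· ≡ c [MOD n])).card +
      ((Finset.Ico (m + j) m').filter (· ≡ c [MOD n])).card ≤
      ((Finset.Ico (m' - (L - m)) m').filter (· ≡ c [MOD n])).card := by
    rw [← Finset.card_union_of_disjoint]
    · refine Finset.card_le_card fun z hz => ?_
      have := hbound.trans (min_le_right _ _)
      simp only [Finset.mem_union, Finset.mem_filter, Finset.mem_Ico, lt_min_iff] at hz ⊢
      rcases hz with ⟨hz, hzc⟩ | ⟨hz, hzc⟩ <;> exact ⟨by omega, hzc⟩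
    · refine Finset.disjoint_filter_filter (Finset.disjoint_left.2 fun z hz hz' => ?_)
      simp only [Finset.mem_Ico, lt_min_iff] at hz hz'
      omega
  have h3 := Nat.mul_le_mul_left d (h2.trans' (Nat.add_le_add_right h1 _))
  rw [mul_add] at h3
  omega

end IsSerialFamily

theorem theorem1p5 {K : Type*} [Field K] {A : Type u} [Ring A] [Algebra K A]
    (hA : IsNakayamaAlgebra K A) (hconn : IsConnectedRing A)
    (M N : ModuleCat.{u} A) (hM : Indecomposable M) (hN : Indecomposable N) :
    (∀ ΩM ΩN : ModuleCat.{u} A, IsFirstSyzygy ΩM M → IsFirstSyzygy ΩN N →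
      min (Module.rank K (ΩM ⟶ M)) (Module.rank K (ΩN ⟶ N)) ≤ Module.rank K (ΩM ⟶ N)) ∧
    min (Module.rank K (Abelian.Ext.{u} M M 1)) (Module.rank K (Abelian.Ext.{u} N N 1)) ≤
      Module.rank K (Abelian.Ext.{u} M N 1) := by
  have := hA.finite
  have : IsArtinianRing A := IsArtinianRing.of_finite K A
  obtain ⟨ι, _, e, h⟩ := hA.exists_isSerialFamily
  choose s x hx using h.exists_arrow
  obtain ⟨i, m, v, hv⟩ := h.exists_hasTop hx hM
  obtain ⟨k, m', v', hv'⟩ := h.exists_hasTop hx hN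
  have hne : ∀ {M : ModuleCat.{u} A} {i : ι} {m : ℕ} {v : M}, Indecomposable M →
      HasTop e s x i m v → v ≠ 0 := by
    rintro M i m v hM hv rfl
    refine hM.1 (ModuleCat.isZero_iff_subsingleton.2 (subsingleton_of_forall_eq 0 fun y => ?_))
    obtain ⟨a, rfl⟩ := hv.generates y
    exact smul_zero a
  -- Ext¹(M, N) is squeezed between the self-Hom minimum and Hom(ΩM, N). The first claim weakens the
  -- upper side, the second the lower.
  have hmin := h.min_rank_hom_le_rank_ext (K := K) hx hconn hv hv'
  obtain ⟨hS, hP⟩ := hv.shortExact_coverMap h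
  obtain ⟨hS', hP'⟩ := hv'.shortExact_coverMap h
  constructor
  · intro ΩM ΩN hΩM hΩN
    obtain ⟨f⟩ := hΩM.nonempty_iso (hv.isProjectiveCover h (hne hM hv))
    obtain ⟨g⟩ := hΩN.nonempty_iso (hv'.isProjectiveCover h (hne hN hv'))
    rw [(Linear.homCongr K f (Iso.refl M)).rank_eq, (Linear.homCongr K g (Iso.refl N)).rank_eq,
      (Linear.homCongr K f (Iso.refl N)).rank_eq]
    exact hmin.trans (rank_ext_le hS N)
  · exact (min_le_min (rank_ext_le hS M) (rank_ext_le hS' N)).trans hmin
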